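/- **Theorem 4.8.** Let $X,Y$ be complex Banach spaces and let $A$ be the generator of a $C_0$-semigroup $(T(t))_{t\ge 0}$ on $X$ that is bounded analytic, i.e. $-A$ is densely defined and sectorial of type $\omega$ for some $\omega\in[0,\frac{\pi}{2})$: writing $\Sigma_\delta=\{0\}\cup\{z\neq 0 : |\arg z|\le\delta\}$ for $0\le\delta<\pi$, one has $\sigma(-A)\subseteq\Sigma_\omega$, and for every $\delta\in(\omega,\pi)$ there is $M_\delta>0$ with $\|zR(z,-A)\|\le M_\delta$ for all $z\in\mathbb C\setminus\Sigma_\delta$, where $R(z,B)=(z-B)^{-1}$. Let $\Phi\in\mathcal P$, i.e. $\Phi:(0,\infty)\to(0,\infty)$ is a bijection and there are $1<p<q<\infty$ and a continuous concave $\rho:(0,\infty)\to(0,\infty)$ with $\rho(st)\le\max(1,s)\rho(t)$ for all $s,t>0$ such that $\Phi^{-1}(t)=t^{1/p}\rho(t^{1/q-1/p})$ for all $t>0$. Extend $\Phi$ by $\Phi(0)=0$, and let $\widetilde\Phi(s)=\sup_{t\ge 0}(st-\Phi(t))$. For measurable $g$ on $(0,\infty)$ let $\|g\|_{L_{\widetilde\Phi}(0,\infty)}=\inf\{k>0:\int_0^\infty\widetilde\Phi(|g(t)|/k)\,dt\le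 1\}$. For $0<\tau\le\infty$ let $L_{\Phi,\infty}(0,\tau;Y)$ be the space of (classes of) strongly measurable $f:(0,\tau)\to Y$ with $$\|f\|_{L_{\Phi,\infty}(0,\tau;Y)}=\sup_{t>0}\frac{f^*(t)}{\Phi^{-1}(1/t)}<\infty,\qquad f^*(t)=\inf\{s\ge 0:\lambda(\{r\in(0,\tau):\|f(r)\|>s\})<t\},$$ where $\lambda$ is Lebesgue measure. Let $C\in\mathcal L(D(A),Y)$, where $D(A)$ carries the graph norm. Then the following are equivalent: 1. (infinite-time $\Phi$-Weiss condition) $\{z:\operatorname{Re}z>0\}\subseteq\rho(A)$ and $\displaystyle\sup_{\operatorname{Re}z>0}\big(\|e^{-\operatorname{Re}z\,\cdot}\|_{L_{\widetilde\Phi}(0,\infty)}\big)^{-1}\,\|CR(z,A)\|<\infty$. 2. There is $M>0$ such that for all $x\in X$ one has $T(t)x\in D(A)$ for all $t>0$ and $\displaystyle\sup_{t>0}\big(\Phi^{-1}(\tfrac1t)\big)^{-1}\|CT(t)x\|\le M\|x\|$. 3. ($C$ is infinite-time $L_{\Phi,\infty}$-admissible) There is $c\ge 0$ such that for all $\tau>0$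 and all $x\in D(A)$ one has $CT(\cdot)x\in L_{\Phi,\infty}(0,\tau;Y)$ and $\|CT(\cdot)x\|_{L_{\Phi,\infty}(0,\tau;Y)}\le c\|x\|$. -/

import Mathlib

open Set Filter Topology MeasureTheory
open scoped ENNReal

noncomputable section

namespace OrliczWeiss

/-! ### Semigroups, generators, resolvents -/

section Semigroups

variable {X : Type*} [NormedAddCommGroup X] [NormedSpace ℂ X]

/-- `(T t)_{t ≥ 0}` is a strongly continuous semigroup (values at negative times are irrelevant). -/
structure IsC0Semigroup (T : ℝ → X →L[ℂ] X) : Prop where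
  map_zero : T 0 = ContinuousLinearMap.id ℂ X
  map_add : ∀ s t : ℝ, 0 ≤ s → 0 ≤ t → T (s + t) = (T s).comp (T t)
  tendsto_zero : ∀ x : X, Tendsto (fun t : ℝ => T t x) (𝓝[>] 0) (𝓝 x)

/-- `A` is the (infinitesimal) generator of `T`: `x ∈ D(A)` and `A x = y` if and only if
`(T h x - x) / h → y` as `h ↓ 0`. -/
def IsGenerator (A : X →ₗ.[ℂ] X) (T : ℝ → X →L[ℂ] X) : Prop :=
  ∀ x y : X, (∃ hx : x ∈ A.domain, A ⟨x, hx⟩ = y) ↔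
    Tendsto (fun h : ℝ => ((h⁻¹ : ℝ) : ℂ) • (T h x - x)) (𝓝[>] 0) (𝓝 y)

/-- The bounded operator `R` is the inverse of `z - A : D(A) → X`. -/
def IsResolventAt (A : X →ₗ.[ℂ] X) (z : ℂ) (R : X →L[ℂ] X) : Prop :=
  (∀ x : X, ∃ hx : R x ∈ A.domain, z • R x - A ⟨R x, hx⟩ = x) ∧
    ∀ x : A.domain, R (z • (x : X) - A x) = x

/-- The resolvent set `ρ(A)`. -/
def resolventSet (A : X →ₗ.[ℂ] X) : Set ℂ := {z | ∃ R : X →L[ℂ] X, IsResolventAt A z R}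

/-- The spectrum `σ(A)`. -/
def spectrum (A : X →ₗ.[ℂ] X) : Set ℂ := (resolventSet A)ᶜ

open Classical in
/-- The resolvent `R(z, A) = (z - A)⁻¹` for `z ∈ ρ(A)` (and `0` for other `z`). -/
def resolvent (A : X →ₗ.[ℂ] X) (z : ℂ) : X →L[ℂ] X :=
  if h : ∃ R : X →L[ℂ] X, IsResolventAt A z R then h.choose else 0

/-- For `0 ≤ δ < π`, the closure of the open sector `{z ≠ 0 | |arg z| < δ}` (of `(0, ∞)` if
`δ = 0`). It contains the origin, as `Complex.arg 0 = 0`. -/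
def closedSector (δ : ℝ) : Set ℂ := {z | |z.arg| ≤ δ}

/-- `B` is sectorial of type `ω`. -/
def IsSectorialOfType (B : X →ₗ.[ℂ] X) (ω : ℝ) : Prop :=
  spectrum B ⊆ closedSector ω ∧
    ∀ δ : ℝ, ω < δ → δ < Real.pi → ∃ M : ℝ, 0 < M ∧
      ∀ z : ℂ, z ∉ closedSector δ → ‖z • resolvent B z‖ ≤ M

/-- `A` generates a bounded analytic semigroup: `-A` is densely defined and sectorial of some
type `ω ∈ [0, π/2)`. -/
def GeneratesBoundedAnalytic (A : X →ₗ.[ℂ] X) : Prop :=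
  Dense (A.domain : Set X) ∧
    ∃ ω : ℝ, 0 ≤ ω ∧ ω < Real.pi / 2 ∧ IsSectorialOfType (-A) ω

end Semigroups

/-! ### Young functions and the Luxemburg norm

A function `Φ : (0, ∞) → (0, ∞)` is represented by a function `ℝ → ℝ`, extended by `Φ 0 = 0`;
its values at negative numbers are never used. -/

/-- The inverse of `Φ : (0, ∞) → (0, ∞)`. -/
def inv (Φ : ℝ → ℝ) : ℝ → ℝ := Function.invFunOn Φ (Ioi 0)

/-- The class `𝒫`. -/
def ClassP (Φ : ℝ → ℝ) : Prop :=
  Φ 0 = 0 ∧ BijOn Φ (Ioi 0) (Ioi 0) ∧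
    ∃ (p q : ℝ) (ρ : ℝ → ℝ), 1 < p ∧ p < q ∧
      (∀ t, 0 < t → 0 < ρ t) ∧ ContinuousOn ρ (Ioi 0) ∧ ConcaveOn ℝ (Ioi 0) ρ ∧
      (∀ s t, 0 < s → 0 < t → ρ (s * t) ≤ max 1 s * ρ t) ∧
      ∀ t, 0 < t → inv Φ t = t ^ (1 / p) * ρ (t ^ (1 / q - 1 / p))

/-- The complementary Young function `s ↦ sup_{t ≥ 0} (s t - Φ t)`, with values in `[0, ∞]`.
The term at `t = 0` is `0`, so that truncating negative terms to `0` does not change the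
supremum. -/
def complementary (Φ : ℝ → ℝ) (s : ℝ) : ℝ≥0∞ :=
  ⨆ (t : ℝ) (_ : 0 ≤ t), ENNReal.ofReal (s * t - Φ t)

/-- The Luxemburg norm `inf {k > 0 | ∫ φ(‖f‖ / k) dμ ≤ 1}`. -/
def luxemburgNorm {Y : Type*} [NormedAddCommGroup Y] (φ : ℝ → ℝ≥0∞) (f : ℝ → Y)
    (μ : Measure ℝ) : ℝ≥0∞ :=
  ⨅ (k : ℝ) (_ : 0 < k) (_ : ∫⁻ t, φ (‖f t‖ / k) ∂μ ≤ 1), ENNReal.ofReal k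

/-! ### Weak Orlicz spaces -/

/-- The decreasing rearrangement `f^*(t) = inf {s ≥ 0 | μ(‖f‖ > s) < t}`. -/
def rearrangement {Y : Type*} [NormedAddCommGroup Y] (f : ℝ → Y) (μ : Measure ℝ) (t : ℝ) :
    ℝ≥0∞ :=
  ⨅ (s : ℝ) (_ : 0 ≤ s) (_ : μ {ω | s < ‖f ω‖} < ENNReal.ofReal t), ENNReal.ofReal s

/-- The quasi-norm `sup_{t > 0} Φ⁻¹(1 / t)⁻¹ f^*(t)` of the weak Orlicz space `L_{Φ,∞}`. -/
def weakOrliczNorm {Y : Type*} [NormedAddCommGroup Y] (Φ : ℝ → ℝ) (f : ℝ → Y)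
    (μ : Measure ℝ) : ℝ≥0∞ :=
  ⨆ (t : ℝ) (_ : 0 < t), (ENNReal.ofReal (inv Φ (1 / t)))⁻¹ * rearrangement f μ t

/-- Membership in the weak Orlicz space `L_{Φ,∞}`. -/
def MemWeakOrlicz {Y : Type*} [NormedAddCommGroup Y] (Φ : ℝ → ℝ) (f : ℝ → Y)
    (μ : Measure ℝ) : Prop :=
  AEStronglyMeasurable f μ ∧ weakOrliczNorm Φ f μ < ∞

/-! ### Observation operators -/

section Observation

variable {X Y : Type*} [NormedAddCommGroup X] [NormedSpace ℂ X]
  [NormedAddCommGroup Y] [NormedSpace ℂ Y]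

/-- `C : D(A) → Y` is bounded with respect to the graph norm of `A`, i.e. `C ∈ ℒ(D(A), Y)`. -/
def IsGraphBounded (A : X →ₗ.[ℂ] X) (C : A.domain →ₗ[ℂ] Y) : Prop :=
  ∃ K : ℝ, ∀ x : A.domain, ‖C x‖ ≤ K * (‖(x : X)‖ + ‖A x‖)

open Classical in
/-- `C x` for `x ∈ D(A)` (and `0` for other `x`). -/
def evalAt {A : X →ₗ.[ℂ] X} (C : A.domain →ₗ[ℂ] Y) (x : X) : Y :=
  if hx : x ∈ A.domain then C ⟨x, hx⟩ else 0

/-- The operator norm `sup_{‖x‖ ≤ 1} ‖S x‖ ∈ [0, ∞]` of an everywhere defined linear `S`. -/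
def opNorm (S : X → Y) : ℝ≥0∞ := ⨆ (x : X) (_ : ‖x‖ ≤ 1), ‖S x‖ₑ

/-- The infinite-time `Φ`-Weiss condition: the right half-plane `Re z > 0` lies in `ρ(A)` and
`sup_{Re z > 0} ‖e^{-Re z ·}‖_{L_{Φ̃}(0,∞)}⁻¹ ‖C R(z, A)‖ < ∞`, where `Φ̃` is complementary
to `Φ`. -/
def InfiniteTimeWeiss (A : X →ₗ.[ℂ] X) (C : A.domain →ₗ[ℂ] Y) (Φ : ℝ → ℝ) : Prop :=
  {z : ℂ | 0 < z.re} ⊆ resolventSet A ∧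
    ⨆ (z : ℂ) (_ : 0 < z.re),
      (luxemburgNorm (complementary Φ) (fun t : ℝ => Real.exp (-z.re * t))
          (volume.restrict (Ioi 0)))⁻¹ *
        opNorm (fun x : X => evalAt C (resolvent A z x)) < ∞

/-- `C` is infinite-time `L_{Φ,∞}`-admissible for `T`: for every `τ > 0` and `x ∈ D(A)` the
function `C T(·) x` belongs to `L_{Φ,∞}(0, τ; Y)` with quasi-norm at most `c ‖x‖`, where `c` does
not depend on `τ` and `x`. -/
def InfiniteTimeWeakAdmissible (A : X →ₗ.[ℂ] X) (T : ℝ → X →L[ℂ] X) (C : A.domain →ₗ[ℂ] Y)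
    (Φ : ℝ → ℝ) : Prop :=
  ∃ c : ℝ, 0 ≤ c ∧ ∀ τ : ℝ, 0 < τ → ∀ x ∈ A.domain,
    MemWeakOrlicz Φ (fun t => evalAt C (T t x)) (volume.restrict (Ioo 0 τ)) ∧
      weakOrliczNorm Φ (fun t => evalAt C (T t x)) (volume.restrict (Ioo 0 τ)) ≤
        ENNReal.ofReal (c * ‖x‖)

end Observation

end OrliczWeiss

end

/-!
Write `ψ = inv Φ`. The three conditions are linked in the cycle: Weiss condition, pointwise bound on
`C T(t)`, weak admissibility, Weiss condition.

*Young functions.* The representation of `ψ` in the class `𝒫` makes `ψ` nondecreasing with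
`ψ(t) ≤ (t / s)^(1 / p) ψ(s)` for `s ≤ t`. With `p > 1` this gives two-sided bounds of the
Luxemburg norm of `exp (-r ·)` by multiples of `ψ(r) / r`
(`ClassP.luxemburgNorm_exp_le`, `ClassP.le_luxemburgNorm_exp`), so that the Weiss condition reads
`‖C R(z, A)‖ ≤ K ψ(Re z) / Re z` (`infiniteTimeWeiss_iff`). It also gives
`∫₀^t ‖f‖ ≤ L ‖f‖_{Φ,∞} t ψ(1 / t)` (`ClassP.exists_lintegral_le`).

*Analytic semigroups.* The only facts needed are that `T` is bounded, that `T(t)` maps `X` into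
`D(A)`, and that `‖A T(t)‖ ≤ K / t` (`GeneratesBoundedAnalytic.exists_bounds`). They follow from
`‖z R(z, A)‖ ≤ M` on `Re z > 0` without deforming contours: `2 R(z, A)^3 y` is the Laplace transform
of `t^2 T(t) y`, and it decays like `|z|^(-2)` on vertical lines both for `y = x` and for `y = A x`,
so that Fourier inversion on the line `Re z = 1 / t` gives the estimates. That line may be used
because the growth bound is not positive (`hasExpBound_of_resolvent_bound`).

*The cycle.* The Weiss condition at `z = 1 / t` gives the pointwise bound through
`C T(t) x = C R(z, A) (z - A) T(t) x`. The pointwise bound gives weak admissibility because `ψ` is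
doubling. Given weak admissibility, for `x ∈ D(A)` and `B = C R(a, A)` with `a > 0`,
`B x - exp (-a t) B T(t) x = ∫₀^t exp (-a s) C T(s) x ds`; for `t` a large multiple of `1 / a` the
second term on the left is absorbed, and the right-hand side is at most a multiple of
`‖x‖ ψ(a) / a`. The resolvent identity extends the bound from `a` to all `z` with `Re z = a`.
-/

namespace OrliczWeiss

/-! ### Young functions of class `𝒫` -/

section Young

variable {Φ : ℝ → ℝ}

theorem ClassP.inv_pos (hΦ : ClassP Φ) {t : ℝ} (ht : 0 < t) : 0 < inv Φ t :=
  hΦ.2.1.surjOn.mapsTo_invFunOn ht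

theorem ClassP.apply_inv (hΦ : ClassP Φ) {t : ℝ} (ht : 0 < t) : Φ (inv Φ t) = t :=
  hΦ.2.1.surjOn.rightInvOn_invFunOn ht

theorem ClassP.inv_apply (hΦ : ClassP Φ) {t : ℝ} (ht : 0 < t) : inv Φ (Φ t) = t :=
  hΦ.2.1.injOn.leftInvOn_invFunOn ht

theorem ClassP.apply_pos (hΦ : ClassP Φ) {t : ℝ} (ht : 0 < t) : 0 < Φ t :=
  hΦ.2.1.mapsTo ht

/-- The growth of `inv Φ`: monotonicity comes from `ρ (s t) ≤ s ρ t` for `s ≥ 1`, the upper bound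
from the monotonicity of `ρ`. -/
theorem ClassP.exists_inv_le_rpow_mul (hΦ : ClassP Φ) :
    ∃ p : ℝ, 1 < p ∧ ∀ s t : ℝ, 0 < s → s ≤ t →
      inv Φ s ≤ inv Φ t ∧ inv Φ t ≤ (t / s) ^ (1 / p) * inv Φ s := by
  obtain ⟨-, -, p, q, ρ, hp, hpq, hpos, -, -, hρ, h⟩ := hΦ
  have hp0 : 0 < p := by linarith
  have hq0 : 0 < q := by linarith
  have hκ : 0 ≤ 1 / p - 1 / q := sub_nonneg.2 (one_div_le_one_div_of_le hp0 hpq.le)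
  have hq1 : 0 ≤ 1 / q := by positivity
  refine ⟨p, hp, fun s t hs hst => ?_⟩
  have ht : 0 < t := hs.trans_le hst
  have hts : 1 ≤ t / s := (one_le_div hs).2 hst
  have hs' : 0 < s ^ (1 / q - 1 / p) := Real.rpow_pos_of_pos hs _
  have ht' : 0 < t ^ (1 / q - 1 / p) := Real.rpow_pos_of_pos ht _
  have hsp : 0 < s ^ (1 / p) := Real.rpow_pos_of_pos hs _
  have htp : t ^ (1 / p) = (t / s) ^ (1 / p) * s ^ (1 / p) := by
    rw [← Real.mul_rpow (by positivity) hs.le, div_mul_cancel₀ _ hs.ne']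
  rw [h s hs, h t ht]
  constructor
  · have h1 : s ^ (1 / q - 1 / p) = (t / s) ^ (1 / p - 1 / q) * t ^ (1 / q - 1 / p) := by
      rw [show 1 / q - 1 / p = -(1 / p - 1 / q) by ring, Real.rpow_neg hs.le, Real.rpow_neg ht.le,
        Real.div_rpow ht.le hs.le]
      have := (Real.rpow_pos_of_pos ht (1 / p - 1 / q)).ne'
      field_simp
    have h2 := hρ ((t / s) ^ (1 / p - 1 / q)) _ (by positivity) ht'
    rw [← h1, max_eq_right (Real.one_le_rpow hts hκ)] at h2
    have h3 : (t / s) ^ (1 / p - 1 / q) ≤ (t / s) ^ (1 / p) :=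
      Real.rpow_le_rpow_of_exponent_le hts (by linarith)
    calc s ^ (1 / p) * ρ (s ^ (1 / q - 1 / p))
        ≤ s ^ (1 / p) * ((t / s) ^ (1 / p) * ρ (t ^ (1 / q - 1 / p))) := by
          gcongr
          exact h2.trans (mul_le_mul_of_nonneg_right h3 (hpos _ ht').le)
      _ = _ := by rw [htp]; ring
  · have h1 : t ^ (1 / q - 1 / p) =
        (t ^ (1 / q - 1 / p) / s ^ (1 / q - 1 / p)) * s ^ (1 / q - 1 / p) := by
      field_simp
    have h2 := hρ (t ^ (1 / q - 1 / p) / s ^ (1 / q - 1 / p)) _ (by positivity) hs'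
    rw [← h1, max_eq_left, one_mul] at h2
    · rw [htp, mul_assoc]
      gcongr
    · rw [div_le_one hs']
      exact Real.rpow_le_rpow_of_nonpos hs hst (by linarith)

theorem ClassP.inv_mono (hΦ : ClassP Φ) {s t : ℝ} (hs : 0 < s) (hst : s ≤ t) :
    inv Φ s ≤ inv Φ t := by
  obtain ⟨p, -, h⟩ := hΦ.exists_inv_le_rpow_mul
  exact (h s t hs hst).1

theorem ClassP.inv_le_div_mul (hΦ : ClassP Φ) {s t : ℝ} (hs : 0 < s) (hst : s ≤ t) :
    inv Φ t ≤ t / s * inv Φ s := by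
  obtain ⟨p, hp, h⟩ := hΦ.exists_inv_le_rpow_mul
  refine (h s t hs hst).2.trans (mul_le_mul_of_nonneg_right ?_ (hΦ.inv_pos hs).le)
  have hts : 1 ≤ t / s := (one_le_div hs).2 hst
  simpa using Real.rpow_le_rpow_of_exponent_le hts
    (show 1 / p ≤ 1 from (div_le_one (by linarith)).2 hp.le)

/-- Since `inv Φ v / inv Φ r ≤ max 1 (v / r)`, the complementary function of `Φ` is at most
`r exp (-r t)` at `r exp (-r t) / inv Φ r`. -/
theorem ClassP.luxemburgNorm_exp_le (hΦ : ClassP Φ) {r : ℝ} (hr : 0 < r) :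
    luxemburgNorm (complementary Φ) (fun t : ℝ => Real.exp (-r * t)) (volume.restrict (Ioi 0)) ≤
      ENNReal.ofReal (inv Φ r / r) := by
  have hψ := hΦ.inv_pos hr
  refine iInf_le_of_le (inv Φ r / r) (iInf_le_of_le (by positivity) (iInf_le_of_le ?_ le_rfl))
  calc ∫⁻ t in Ioi 0, complementary Φ (‖Real.exp (-r * t)‖ / (inv Φ r / r))
      ≤ ∫⁻ t in Ioi 0, ENNReal.ofReal (r * Real.exp (-r * t)) := by
        refine setLIntegral_mono (by fun_prop) fun t (ht : 0 < t) => ?_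
        have he1 : Real.exp (-r * t) ≤ 1 := Real.exp_le_one_iff.2 (by nlinarith)
        have he0 := Real.exp_pos (-r * t)
        rw [Real.norm_of_nonneg he0.le]
        refine iSup₂_le fun u hu => ENNReal.ofReal_le_ofReal ?_
        rcases hu.eq_or_lt with rfl | hu
        · rw [hΦ.1]
          simp only [mul_zero, sub_zero]
          positivity
        have hv := hΦ.apply_pos hu
        set v := Φ u with hvdef
        have huv : u = inv Φ v := (hΦ.inv_apply hu).symm
        have key : Real.exp (-r * t) / (inv Φ r / r) * u =
            r * Real.exp (-r * t) * (inv Φ v / inv Φ r) := by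
          rw [huv]; field_simp
        rw [key]
        rcases le_total v r with h | h
        · have : inv Φ v / inv Φ r ≤ 1 := (div_le_one hψ).2 (hΦ.inv_mono hv h)
          have := mul_le_mul_of_nonneg_left this (mul_pos hr he0).le
          linarith
        · have : inv Φ v / inv Φ r ≤ v / r := (div_le_iff₀ hψ).2 (hΦ.inv_le_div_mul hr h)
          have h1 := mul_le_mul_of_nonneg_left this (mul_pos hr he0).le
          have h2 : r * Real.exp (-r * t) * (v / r) = Real.exp (-r * t) * v := by field_simp
          nlinarith [mul_pos hr he0]
    _ = 1 := by
        rw [← ofReal_integral_eq_lintegral_ofReal]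
        · rw [integral_const_mul, integral_exp_mul_Ioi (by linarith)]
          simp [hr.ne']
        · exact (integrableOn_exp_mul_Ioi (by linarith) 0).const_mul r
        · exact ae_of_all _ fun t => by positivity

/-- Tests the modular on `(0, 1 / r]` with the point `inv Φ r` in the supremum that defines the
complementary function. -/
theorem ClassP.le_luxemburgNorm_exp (hΦ : ClassP Φ) {r : ℝ} (hr : 0 < r) :
    ENNReal.ofReal (inv Φ r / (2 * Real.exp 1 * r)) ≤
      luxemburgNorm (complementary Φ) (fun t : ℝ => Real.exp (-r * t))
        (volume.restrict (Ioi 0)) := by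
  have hψ := hΦ.inv_pos hr
  refine le_iInf fun k => le_iInf fun hk => le_iInf fun h => ENNReal.ofReal_le_ofReal ?_
  have h1 : ∫⁻ _ in Ioc 0 (1 / r), ENNReal.ofReal (Real.exp (-1) / k * inv Φ r - r) ≤ 1 := by
    refine le_trans ?_ h
    refine le_trans (setLIntegral_mono' measurableSet_Ioc fun t ht => ?_)
      (lintegral_mono_set Ioc_subset_Ioi_self)
    refine le_trans (ENNReal.ofReal_le_ofReal ?_) (le_iSup₂_of_le (inv Φ r) hψ.le le_rfl)
    rw [hΦ.apply_inv hr, Real.norm_of_nonneg (Real.exp_pos _).le]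
    have : -1 ≤ -r * t := by
      have := mul_le_mul_of_nonneg_left ht.2 hr.le
      rw [mul_one_div_cancel hr.ne'] at this
      linarith
    gcongr
  rw [setLIntegral_const, Real.volume_Ioc, sub_zero, ← ENNReal.ofReal_mul' (by positivity),
    ENNReal.ofReal_le_one] at h1
  rw [Real.exp_neg] at h1
  have he := Real.exp_pos 1
  rw [div_le_iff₀ (by positivity)]
  have h2 : ((Real.exp 1)⁻¹ / k * inv Φ r - r) * (1 / r) =
    inv Φ r / (Real.exp 1 * k * r) - 1 := by field_simp
  rw [h2, sub_le_iff_le_add, div_le_iff₀ (by positivity)] at h1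
  linarith

end Young

/-! ### Weak Orlicz norms -/

section WeakOrlicz

variable {Φ : ℝ → ℝ} {Y : Type*} [NormedAddCommGroup Y]

/-- Upper bound by the weak Orlicz function `t ↦ inv Φ (1 / t)`. The factor `2` comes from
testing the rearrangement at `t` with the superlevel set at `t / 2`, as its definition asks for a
strict inequality. -/
theorem ClassP.weakOrliczNorm_le (hΦ : ClassP Φ) {f : ℝ → Y} {τ K : ℝ} (hK : 0 ≤ K)
    (hf : ∀ r ∈ Ioo 0 τ, ‖f r‖ ≤ K * inv Φ (1 / r)) :
    weakOrliczNorm Φ f (volume.restrict (Ioo 0 τ)) ≤ ENNReal.ofReal (2 * K) := by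
  refine iSup₂_le fun t ht => ?_
  have hψ := hΦ.inv_pos (one_div_pos.2 ht)
  have hψ2 := hΦ.inv_pos (show 0 < 1 / (t / 2) by positivity)
  rw [mul_comm, ← div_eq_mul_inv]
  refine ENNReal.div_le_of_le_mul ?_
  rw [← ENNReal.ofReal_mul (by positivity)]
  refine iInf_le_of_le (K * inv Φ (1 / (t / 2))) (iInf_le_of_le (by positivity)
    (iInf_le_of_le ?_ (ENNReal.ofReal_le_ofReal ?_)))
  · calc (volume.restrict (Ioo 0 τ)) {ω | K * inv Φ (1 / (t / 2)) < ‖f ω‖}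
        ≤ volume (Ioc 0 (t / 2)) := by
          rw [Measure.restrict_apply' measurableSet_Ioo]
          refine measure_mono fun r hr => ⟨hr.2.1, ?_⟩
          by_contra! hlt
          have h1 : K * inv Φ (1 / (t / 2)) < ‖f r‖ := hr.1
          have h2 := hf r hr.2
          have h3 := hΦ.inv_mono (one_div_pos.2 hr.2.1)
            (one_div_le_one_div_of_le (by positivity) hlt.le)
          nlinarith
      _ = ENNReal.ofReal (t / 2) := by simp
      _ < ENNReal.ofReal t := (ENNReal.ofReal_lt_ofReal_iff ht).2 (by linarith)
  · have h1 := hΦ.inv_le_div_mul (one_div_pos.2 ht)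
      (one_div_le_one_div_of_le (show 0 < t / 2 by positivity) (by linarith))
    have h2 : 1 / (t / 2) / (1 / t) = 2 := by field_simp
    rw [h2] at h1
    nlinarith

theorem ClassP.measure_lt_norm_le (hΦ : ClassP Φ) {f : ℝ → Y} {μ : Measure ℝ} {K t : ℝ}
    (hK : 0 < K) (ht : 0 < t) (hf : weakOrliczNorm Φ f μ ≤ ENNReal.ofReal K) :
    μ {r | 2 * K * inv Φ (1 / t) < ‖f r‖} ≤ ENNReal.ofReal t := by
  have hψ := hΦ.inv_pos (one_div_pos.2 ht)
  have h1 : rearrangement f μ t < ENNReal.ofReal (2 * K * inv Φ (1 / t)) := by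
    have h := (le_iSup₂ (f := fun (t : ℝ) (_ : 0 < t) =>
      (ENNReal.ofReal (inv Φ (1 / t)))⁻¹ * rearrangement f μ t) t ht).trans hf
    rw [mul_comm, ← div_eq_mul_inv, ENNReal.div_le_iff (by simpa using hψ) (by simp),
      ← ENNReal.ofReal_mul hK.le] at h
    refine h.trans_lt ((ENNReal.ofReal_lt_ofReal_iff (by positivity)).2 ?_)
    nlinarith [mul_pos hK hψ]
  simp only [rearrangement, iInf_lt_iff] at h1
  obtain ⟨s, hs, hμ, h2⟩ := h1
  have h3 := (ENNReal.ofReal_lt_ofReal_iff (by positivity)).1 h2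
  exact (measure_mono fun r hr => h3.trans hr).trans hμ.le

/-- The weak Orlicz space embeds locally into `L¹`, with the scaling of the function
`t ↦ inv Φ (1 / t)`: the upper index `1 / p < 1` of `inv Φ` bounds the distribution
function of `f` on `(0, τ)` by a multiple of that of `t ↦ t ^ (-1 / p)`. -/
theorem ClassP.exists_lintegral_le (hΦ : ClassP Φ) :
    ∃ L : ℝ, 0 < L ∧ ∀ (f : ℝ → Y) (τ K : ℝ), 0 < τ → 0 < K →
      AEStronglyMeasurable f (volume.restrict (Ioo 0 τ)) →
      weakOrliczNorm Φ f (volume.restrict (Ioo 0 τ)) ≤ ENNReal.ofReal K →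
      ∫⁻ r in Ioo 0 τ, ENNReal.ofReal ‖f r‖ ≤ ENNReal.ofReal (L * K * (τ * inv Φ (1 / τ))) := by
  obtain ⟨p, hp, hψp⟩ := hΦ.exists_inv_le_rpow_mul
  have hp1 : 0 < p - 1 := by linarith
  refine ⟨2 * (1 + 1 / (p - 1)), by positivity, fun f τ K hτ hK hfm hf => ?_⟩
  have hψ := hΦ.inv_pos (one_div_pos.2 hτ)
  set D := 2 * K * inv Φ (1 / τ) with hD
  have hD0 : 0 < D := by positivity
  -- the distribution function of `f` is that of a function in weak `L^p`
  have hdist : ∀ s, D < s → (volume.restrict (Ioo 0 τ)) {r | s < ‖f r‖} ≤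
      ENNReal.ofReal (τ * D ^ p * s ^ (-p)) := by
    intro s hs
    have hs0 : 0 < s := hD0.trans hs
    have hu : 1 ≤ s / D := (one_le_div hD0).2 hs.le
    have hup : 1 ≤ (s / D) ^ p := Real.one_le_rpow hu (by linarith)
    have ht : 0 < τ / (s / D) ^ p := by positivity
    have hle := (hψp (1 / τ) (1 / (τ / (s / D) ^ p)) (by positivity)
      (one_div_le_one_div_of_le ht (div_le_self hτ.le hup))).2
    have hr : (1 / (τ / (s / D) ^ p) / (1 / τ)) ^ (1 / p) = s / D := by
      rw [show 1 / (τ / (s / D) ^ p) / (1 / τ) = (s / D) ^ p by field_simp, one_div]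
      exact Real.rpow_rpow_inv (by positivity) (by linarith)
    rw [hr] at hle
    have h1 := hΦ.measure_lt_norm_le hK ht hf
    refine (measure_mono ?_).trans (h1.trans_eq ?_)
    · refine fun r (hr : s < ‖f r‖) => lt_of_le_of_lt ?_ hr
      calc 2 * K * inv Φ (1 / (τ / (s / D) ^ p))
          ≤ 2 * K * (s / D * inv Φ (1 / τ)) := by gcongr
        _ = s := by rw [hD]; field_simp
    · rw [Real.div_rpow hs0.le hD0.le, Real.rpow_neg hs0.le]
      congr 1
      field_simp
  rw [lintegral_eq_lintegral_meas_lt _ (ae_of_all _ fun r => norm_nonneg _)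
    hfm.norm.aemeasurable, ← Ioc_union_Ioi_eq_Ioi hD0.le]
  refine (lintegral_union_le _ _ _).trans ?_
  have hA : ∫⁻ s in Ioc 0 D, (volume.restrict (Ioo 0 τ)) {r | s < ‖f r‖} ≤
      ENNReal.ofReal (τ * D) := by
    calc _ ≤ ∫⁻ _ in Ioc 0 D, ENNReal.ofReal τ := by
          refine lintegral_mono fun s => (measure_mono (subset_univ _)).trans_eq ?_
          simp
      _ = _ := by
          rw [setLIntegral_const, Real.volume_Ioc, sub_zero, ENNReal.ofReal_mul hτ.le]
  have hB : ∫⁻ s in Ioi D, (volume.restrict (Ioo 0 τ)) {r | s < ‖f r‖} ≤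
      ENNReal.ofReal (τ * D / (p - 1)) := by
    calc _ ≤ ∫⁻ s in Ioi D, ENNReal.ofReal (τ * D ^ p * s ^ (-p)) :=
          setLIntegral_mono' measurableSet_Ioi fun s hs => hdist s hs
      _ = _ := by
          rw [← ofReal_integral_eq_lintegral_ofReal]
          · rw [integral_const_mul, integral_Ioi_rpow_of_lt (by linarith) hD0]
            congr 1
            have : D ^ p * D ^ (-p + 1) = D := by
              rw [← Real.rpow_add hD0]; simp
            have h3 : -D ^ (-p + 1) / (-p + 1) = D ^ (-p + 1) / (p - 1) := by
              rw [← neg_div_neg_eq]; congr 1 <;> ring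
            calc τ * D ^ p * (-D ^ (-p + 1) / (-p + 1))
                = τ * (D ^ p * D ^ (-p + 1)) / (p - 1) := by rw [h3]; ring
              _ = τ * D / (p - 1) := by rw [this]
          · exact (integrableOn_Ioi_rpow_of_lt (by linarith) hD0).const_mul _
          · filter_upwards [ae_restrict_mem measurableSet_Ioi] with s hs
            have : 0 < s := hD0.trans hs
            positivity
  refine (add_le_add hA hB).trans ?_
  rw [← ENNReal.ofReal_add (by positivity) (by positivity)]
  refine ENNReal.ofReal_le_ofReal (le_of_eq ?_)
  rw [hD]; field_simp

end WeakOrlicz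

/-! ### Strongly continuous semigroups -/

section Semigroup

variable {X : Type*} [NormedAddCommGroup X] [NormedSpace ℂ X]
  {T : ℝ → X →L[ℂ] X} {A : X →ₗ.[ℂ] X}

/-- The semigroup grows at most like `t ↦ exp (b t)`. -/
def HasExpBound (T : ℝ → X →L[ℂ] X) (b : ℝ) : Prop :=
  ∃ K : ℝ, 0 ≤ K ∧ ∀ t, 0 ≤ t → ‖T t‖ ≤ K * Real.exp (b * t)

/-- Uniform boundedness near `0`, by the Banach-Steinhaus theorem along a sequence of times. -/
theorem IsC0Semigroup.exists_norm_le [CompleteSpace X] (hT : IsC0Semigroup T) :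
    ∃ δ K : ℝ, 0 < δ ∧ 1 ≤ K ∧ ∀ t ∈ Icc 0 δ, ‖T t‖ ≤ K := by
  by_contra! h
  choose t ht htn using fun n : ℕ => h (1 / ((n : ℝ) + 1)) (n + 1) (by positivity) (by simp)
  have hpos : ∀ n, 0 < t n := fun n => by
    refine (ht n).1.lt_of_ne fun h0 => ?_
    have h1 := htn n
    rw [← h0, hT.map_zero] at h1
    have h2 := ContinuousLinearMap.norm_id_le (𝕜 := ℂ) (E := X)
    have : (0 : ℝ) ≤ n := n.cast_nonneg
    linarith
  have htend : Tendsto t atTop (𝓝[>] 0) := by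
    refine tendsto_nhdsWithin_iff.2 ⟨?_, Eventually.of_forall hpos⟩
    exact squeeze_zero (fun n => (hpos n).le) (fun n => (ht n).2)
      tendsto_one_div_add_atTop_nhds_zero_nat
  obtain ⟨K, hK⟩ := banach_steinhaus (g := fun n => T (t n)) fun x => by
    obtain ⟨C, hC⟩ := ((hT.tendsto_zero x).comp htend).norm.bddAbove_range
    exact ⟨C, fun n => hC ⟨n, rfl⟩⟩
  obtain ⟨n, hn⟩ := exists_nat_gt K
  linarith [htn n, hK n]

theorem IsC0Semigroup.norm_nat_mul_add_le (hT : IsC0Semigroup T) {t s : ℝ} (ht : 0 ≤ t)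
    (hs : 0 ≤ s) (n : ℕ) : ‖T (n * t + s)‖ ≤ ‖T t‖ ^ n * ‖T s‖ := by
  induction n with
  | zero => simp
  | succ n ih =>
    have h : ((n + 1 : ℕ) : ℝ) * t + s = t + (n * t + s) := by push_cast; ring
    rw [h, hT.map_add _ _ ht (by positivity), pow_succ', mul_assoc]
    exact (ContinuousLinearMap.opNorm_comp_le _ _).trans
      (mul_le_mul_of_nonneg_left ih (norm_nonneg _))

/-- A bound on a compact interval together with the bound `exp (b t₀)` at its end point `t₀`
propagates to all times. -/
theorem IsC0Semigroup.hasExpBound_of_norm_le (hT : IsC0Semigroup T) {t₀ K b : ℝ} (ht₀ : 0 < t₀)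
    (hb : 0 ≤ b) (hK : ∀ t ∈ Icc 0 t₀, ‖T t‖ ≤ K) (h : ‖T t₀‖ ≤ Real.exp (b * t₀)) :
    HasExpBound T b := by
  have hK0 : 0 ≤ K := (norm_nonneg _).trans (hK 0 ⟨le_rfl, ht₀.le⟩)
  refine ⟨K, hK0, fun t ht => ?_⟩
  set n := ⌊t / t₀⌋₊
  have h1 : (n : ℝ) * t₀ ≤ t := (le_div_iff₀ ht₀).1 (Nat.floor_le (by positivity))
  have h2 : t < (n + 1) * t₀ := (div_lt_iff₀ ht₀).1 (Nat.lt_floor_add_one _)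
  have h3 := hT.norm_nat_mul_add_le ht₀.le (s := t - n * t₀) (by linarith) n
  rw [add_sub_cancel] at h3
  calc ‖T t‖ ≤ ‖T t₀‖ ^ n * ‖T (t - n * t₀)‖ := h3
    _ ≤ Real.exp (b * t₀) ^ n * K := by
        gcongr
        exact hK _ ⟨by linarith, by linarith⟩
    _ = K * Real.exp (b * (n * t₀)) := by rw [← Real.exp_nat_mul]; ring_nf
    _ ≤ K * Real.exp (b * t) := by gcongr

theorem IsC0Semigroup.exists_hasExpBound [CompleteSpace X] (hT : IsC0Semigroup T) :
    ∃ b, 0 < b ∧ HasExpBound T b := by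
  obtain ⟨δ, K, hδ, hK, h⟩ := hT.exists_norm_le
  have hlog : 0 < Real.log (K + 1) := Real.log_pos (by linarith)
  refine ⟨Real.log (K + 1) / δ, by positivity, hT.hasExpBound_of_norm_le hδ (by positivity) h ?_⟩
  rw [div_mul_cancel₀ _ hδ.ne', Real.exp_log (by linarith)]
  linarith [h δ ⟨hδ.le, le_rfl⟩]

theorem IsC0Semigroup.tendsto_abs (hT : IsC0Semigroup T) (x : X) :
    Tendsto (fun h : ℝ => T |h| x) (𝓝 0) (𝓝 x) := by
  have h1 : Tendsto (fun t : ℝ => T t x) (𝓝[≥] 0) (𝓝 x) := by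
    rw [← Ioi_insert, nhdsWithin_insert, tendsto_sup]
    refine ⟨?_, hT.tendsto_zero x⟩
    have h0 : T 0 x = x := by rw [hT.map_zero]; rfl
    exact (tendsto_pure_nhds (fun t => T t x) 0).trans_eq (by rw [h0])
  refine h1.comp (tendsto_nhdsWithin_iff.2 ⟨?_, Eventually.of_forall fun h => abs_nonneg h⟩)
  exact (continuous_abs.tendsto' 0 0 abs_zero)

/-- Joint continuity of `(t, x) ↦ T t x` on `[0, ∞) × X`. -/
theorem IsC0Semigroup.tendsto_apply [CompleteSpace X] (hT : IsC0Semigroup T) {ι : Type*}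
    {l : Filter ι} {u : ι → ℝ} {t : ℝ} {y : ι → X} {x : X} (ht : 0 ≤ t) (hu : Tendsto u l (𝓝 t))
    (hu0 : ∀ᶠ i in l, 0 ≤ u i) (hy : Tendsto y l (𝓝 x)) :
    Tendsto (fun i => T (u i) (y i)) l (𝓝 (T t x)) := by
  obtain ⟨b, hb, K, hK0, hK⟩ := hT.exists_hasExpBound
  have hdiff : ∀ s r : ℝ, 0 ≤ s → s ≤ r → r ≤ t + 1 →
      ‖T r x - T s x‖ ≤ K * Real.exp (b * (t + 1)) * ‖T |r - s| x - x‖ := by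
    intro s r hs hsr hr
    have h1 : T r x = T s (T (r - s) x) := by
      rw [← ContinuousLinearMap.comp_apply, ← hT.map_add s (r - s) hs (by linarith),
        add_sub_cancel]
    rw [h1, ← map_sub, abs_of_nonneg (by linarith)]
    refine ((T s).le_opNorm _).trans (mul_le_mul_of_nonneg_right ((hK s hs).trans ?_)
      (norm_nonneg _))
    gcongr
    linarith
  have hev : ∀ᶠ i in l, ‖T (u i) (y i) - T t x‖ ≤ K * Real.exp (b * (t + 1)) * ‖y i - x‖ +
      K * Real.exp (b * (t + 1)) * ‖T |u i - t| x - x‖ := by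
    filter_upwards [hu0, hu.eventually_lt_const (lt_add_one t)] with i hi hi1
    have h1 : T (u i) (y i) - T t x = T (u i) (y i - x) + (T (u i) x - T t x) := by
      rw [map_sub]; abel
    rw [h1]
    refine (norm_add_le _ _).trans (add_le_add ?_ ?_)
    · refine ((T (u i)).le_opNorm _).trans (mul_le_mul_of_nonneg_right ((hK _ hi).trans ?_)
        (norm_nonneg _))
      gcongr
    · rcases le_total (u i) t with h | h
      · rw [norm_sub_rev, abs_sub_comm]
        exact hdiff _ _ hi h (by linarith)
      · exact hdiff _ _ ht h hi1.le
  rw [tendsto_iff_norm_sub_tendsto_zero]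
  refine squeeze_zero' (Eventually.of_forall fun i => norm_nonneg _) hev ?_
  have h1 := (tendsto_iff_norm_sub_tendsto_zero.1 hy).const_mul (K * Real.exp (b * (t + 1)))
  have h2 : Tendsto (fun i => u i - t) l (𝓝 0) := by simpa using hu.sub_const t
  have h3 := (tendsto_iff_norm_sub_tendsto_zero.1 ((hT.tendsto_abs x).comp h2)).const_mul
    (K * Real.exp (b * (t + 1)))
  simpa using h1.add h3

theorem IsC0Semigroup.continuousOn [CompleteSpace X] (hT : IsC0Semigroup T) (x : X) :
    ContinuousOn (fun t => T t x) (Ici 0) := fun _ ht =>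
  hT.tendsto_apply ht (tendsto_id.mono_left nhdsWithin_le_nhds)
    (eventually_mem_nhdsWithin) tendsto_const_nhds

theorem IsGenerator.map_apply (hA : IsGenerator A T) (hT : IsC0Semigroup T) (x : A.domain)
    {t : ℝ} (ht : 0 ≤ t) : ∃ hx : T t x ∈ A.domain, A ⟨T t x, hx⟩ = T t (A x) := by
  refine (hA _ _).2 ?_
  have h := ((T t).continuous.tendsto _).comp ((hA x (A x)).1 ⟨x.2, rfl⟩)
  refine h.congr' ?_
  filter_upwards [self_mem_nhdsWithin] with s (hs : 0 < s)
  have h1 : T t (T s x) = T s (T t x) := by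
    rw [← ContinuousLinearMap.comp_apply, ← hT.map_add t s ht hs.le, add_comm,
      hT.map_add s t hs.le ht, ContinuousLinearMap.comp_apply]
  simp [h1]

theorem IsGenerator.hasDerivAt [CompleteSpace X] (hA : IsGenerator A T) (hT : IsC0Semigroup T)
    (x : A.domain) {t : ℝ} (ht : 0 < t) : HasDerivAt (fun s => T s x) (T t (A x)) t := by
  have hd := (hA x (A x)).1 ⟨x.2, rfl⟩
  rw [hasDerivAt_iff_tendsto_slope_left_right]
  constructor
  · have h0 : Tendsto (fun s => t - s) (𝓝[<] t) (𝓝[>] 0) := by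
      refine tendsto_nhdsWithin_iff.2 ⟨?_, ?_⟩
      · exact ((continuous_const.sub continuous_id).tendsto' t 0 (sub_self t)).mono_left
          nhdsWithin_le_nhds
      · filter_upwards [self_mem_nhdsWithin] with s (hs : s < t) using sub_pos.2 hs
    have hpos : ∀ᶠ s in 𝓝[<] t, 0 ≤ s :=
      ((lt_mem_nhds ht).filter_mono nhdsWithin_le_nhds).mono fun s hs => le_of_lt hs
    have h1 := hT.tendsto_apply ht.le (tendsto_id.mono_left nhdsWithin_le_nhds) hpos (hd.comp h0)
    refine h1.congr' ?_
    filter_upwards [hpos, self_mem_nhdsWithin] with s hs (hst : s < t)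
    have h2 : T t x = T s (T (t - s) x) := by
      rw [← ContinuousLinearMap.comp_apply, ← hT.map_add s (t - s) hs (by linarith),
        add_sub_cancel]
    simp only [slope_def_module, Function.comp_apply, id, map_smul, map_sub, ← h2]
    rw [Complex.coe_smul, ← neg_sub t s, ← neg_sub (T t x), inv_neg, neg_smul_neg]
  · have h0 : Tendsto (fun s => s - t) (𝓝[>] t) (𝓝[>] 0) := by
      refine tendsto_nhdsWithin_iff.2 ⟨?_, ?_⟩
      · exact ((continuous_id.sub continuous_const).tendsto' t 0 (sub_self t)).mono_left
          nhdsWithin_le_nhds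
      · filter_upwards [self_mem_nhdsWithin] with s (hs : t < s) using sub_pos.2 hs
    have h1 := ((T t).continuous.tendsto _).comp (hd.comp h0)
    refine h1.congr' ?_
    filter_upwards [self_mem_nhdsWithin] with s (hst : t < s)
    have h2 : T s x = T t (T (s - t) x) := by
      rw [← ContinuousLinearMap.comp_apply, ← hT.map_add t (s - t) ht.le (by linarith),
        add_sub_cancel]
    simp only [slope_def_module, Function.comp_apply, map_smul, map_sub, ← h2]
    rw [Complex.coe_smul]

/-- For `u = R(z, A) v` the function `t ↦ exp (-z t) T t u` is a primitive of
`t ↦ -exp (-z t) T t v`. -/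
theorem IsGenerator.hasDerivAt_exp_smul [CompleteSpace X] (hA : IsGenerator A T)
    (hT : IsC0Semigroup T) (x : A.domain) (z : ℂ) {t : ℝ} (ht : 0 < t) :
    HasDerivAt (fun s : ℝ => Complex.exp (-z * s) • T s x)
      (-(Complex.exp (-z * t) • T t (z • (x : X) - A x))) t := by
  have h1 : HasDerivAt (fun s : ℝ => Complex.exp (-z * s)) (Complex.exp (-z * t) * (-z * 1)) t :=
    (((hasDerivAt_id (t : ℂ)).const_mul (-z)).cexp).comp_ofReal
  refine (h1.smul (hA.hasDerivAt hT x ht)).congr_deriv ?_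
  simp only [map_sub, map_smul, smul_sub, smul_smul]
  rw [mul_one, mul_neg, neg_smul]
  abel

theorem IsC0Semigroup.continuousOn_exp_smul [CompleteSpace X] (hT : IsC0Semigroup T) (x : X)
    (z : ℂ) : ContinuousOn (fun s : ℝ => Complex.exp (-z * s) • T s x) (Ici 0) :=
  ContinuousOn.smul (by fun_prop) (hT.continuousOn x)

end Semigroup

/-! ### Resolvents -/

section Resolvent

variable {X : Type*} [NormedAddCommGroup X] [NormedSpace ℂ X] {A : X →ₗ.[ℂ] X} {z w : ℂ}

theorem IsResolventAt.unique {R S : X →L[ℂ] X} (hR : IsResolventAt A z R)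
    (hS : IsResolventAt A z S) : R = S := by
  ext x
  obtain ⟨hx, h⟩ := hR.1 x
  have h1 := hS.2 ⟨R x, hx⟩
  rw [h] at h1
  exact h1.symm

theorem isResolventAt_resolvent (hz : z ∈ resolventSet A) :
    IsResolventAt A z (resolvent A z) := by
  have hz' : ∃ R : X →L[ℂ] X, IsResolventAt A z R := hz
  rw [resolvent, dif_pos hz']
  exact hz'.choose_spec

theorem resolvent_mem (hz : z ∈ resolventSet A) (x : X) : resolvent A z x ∈ A.domain :=
  ((isResolventAt_resolvent hz).1 x).1

theorem map_resolvent (hz : z ∈ resolventSet A) (x : X) :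
    A ⟨resolvent A z x, resolvent_mem hz x⟩ = z • resolvent A z x - x := by
  obtain ⟨_, h⟩ := (isResolventAt_resolvent hz).1 x
  exact (sub_eq_iff_eq_add.1 h ▸ by abel)

theorem resolvent_smul_sub (hz : z ∈ resolventSet A) (x : A.domain) :
    resolvent A z (z • (x : X) - A x) = x :=
  (isResolventAt_resolvent hz).2 x

theorem resolvent_map (hz : z ∈ resolventSet A) (x : A.domain) :
    resolvent A z (A x) = z • resolvent A z x - x := by
  have h := resolvent_smul_sub hz x
  rw [map_sub, map_smul] at h
  exact (sub_eq_iff_eq_add.1 h ▸ by abel)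

theorem resolvent_eq_resolvent_apply (hz : z ∈ resolventSet A) (hw : w ∈ resolventSet A) (x : X) :
    resolvent A z x = resolvent A w (x + (w - z) • resolvent A z x) := by
  have h := resolvent_smul_sub hw ⟨_, resolvent_mem hz x⟩
  rw [map_resolvent hz] at h
  refine h.symm.trans (congrArg _ ?_)
  rw [sub_smul]
  abel

/-- The generator is closed as soon as its resolvent set is nonempty. -/
theorem mem_domain_of_tendsto (hz : z ∈ resolventSet A) {ι : Type*} {l : Filter ι} [l.NeBot]
    {u : ι → A.domain} {x y : X} (hu : Tendsto (fun i => (u i : X)) l (𝓝 x))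
    (hAu : Tendsto (fun i => A (u i)) l (𝓝 y)) : ∃ hx : x ∈ A.domain, A ⟨x, hx⟩ = y := by
  have h1 : Tendsto (fun i => resolvent A z (z • (u i : X) - A (u i))) l
      (𝓝 (resolvent A z (z • x - y))) :=
    ((resolvent A z).continuous.tendsto _).comp ((hu.const_smul z).sub hAu)
  simp only [resolvent_smul_sub hz] at h1
  have hx : x = resolvent A z (z • x - y) := tendsto_nhds_unique hu h1
  have hxm : x ∈ A.domain := hx ▸ resolvent_mem hz _
  refine ⟨hxm, ?_⟩
  have h2 := map_resolvent hz (z • x - y)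
  simp only [← hx] at h2
  rw [h2]; abel

theorem isResolventAt_neg {R : X →L[ℂ] X} (h : IsResolventAt (-A) z R) :
    IsResolventAt A (-z) (-R) := by
  constructor
  · intro x
    obtain ⟨hx, h⟩ := h.1 x
    have hx' : R x ∈ A.domain := hx
    refine ⟨A.domain.neg_mem hx', ?_⟩
    have h2 : A ⟨(-R) x, A.domain.neg_mem hx'⟩ = -A ⟨R x, hx'⟩ :=
      A.map_neg ⟨R x, hx'⟩
    rw [LinearPMap.neg_apply] at h
    rw [h2]
    simpa using h
  · intro x
    have h1 := h.2 x
    rw [LinearPMap.neg_apply] at h1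
    rw [neg_smul, show -(z • (x : X)) - A x = -(z • (x : X) - -A x) by abel, neg_apply, map_neg,
      neg_neg]
    exact h1

/-- Sectoriality of `-A` of angle less than `π / 2`, reduced to the right half-plane. -/
theorem GeneratesBoundedAnalytic.exists_resolvent_bound (hA : GeneratesBoundedAnalytic A) :
    (∀ z : ℂ, 0 < z.re → z ∈ resolventSet A) ∧
      ∃ M : ℝ, 0 < M ∧ ∀ z : ℂ, 0 < z.re → ‖z‖ * ‖resolvent A z‖ ≤ M := by
  obtain ⟨-, ω, hω, hωπ, hsp, hM⟩ := hA
  have hπ := Real.pi_pos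
  have hsec : ∀ z : ℂ, 0 < z.re → -z ∉ closedSector (Real.pi / 2) := fun z hz h => by
    have := Complex.abs_arg_le_pi_div_two_iff.1 h
    rw [Complex.neg_re] at this
    linarith
  have hres : ∀ z : ℂ, 0 < z.re → -z ∈ resolventSet (-A) := fun z hz => by
    by_contra h
    exact hsec z hz ((hsp h : |(-z).arg| ≤ ω).trans hωπ.le)
  have hres' : ∀ z : ℂ, 0 < z.re → IsResolventAt A z (-resolvent (-A) (-z)) := fun z hz => by
    simpa using isResolventAt_neg (isResolventAt_resolvent (hres z hz))
  obtain ⟨M, hM0, hM⟩ := hM (Real.pi / 2) hωπ (by linarith)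
  have hmem : ∀ z : ℂ, 0 < z.re → z ∈ resolventSet A := fun z hz => ⟨_, hres' z hz⟩
  refine ⟨hmem, M, hM0, fun z hz => ?_⟩
  rw [(isResolventAt_resolvent (hmem z hz)).unique (hres' z hz)]
  simpa [norm_smul] using hM _ (hsec z hz)

end Resolvent

/-! ### Laplace transforms and their inversion -/

section Laplace

variable {X : Type*} [NormedAddCommGroup X] [NormedSpace ℂ X] [CompleteSpace X]
  {T : ℝ → X →L[ℂ] X} {A : X →ₗ.[ℂ] X} {b : ℝ} {z : ℂ}

theorem HasExpBound.exists_norm_exp_smul_le {X : Type*} [NormedAddCommGroup X] [NormedSpace ℂ X]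
    {T : ℝ → X →L[ℂ] X} (hb : HasExpBound T b) (z : ℂ) (y : X) :
    ∃ K : ℝ, 0 ≤ K ∧ ∀ t : ℝ, 0 ≤ t →
      ‖Complex.exp (-z * t) • T t y‖ ≤ K * Real.exp (-(z.re - b) * t) := by
  obtain ⟨K, hK0, hK⟩ := hb
  refine ⟨K * ‖y‖, by positivity, fun t ht => ?_⟩
  have h1 : ‖Complex.exp (-z * t)‖ = Real.exp (-z.re * t) := by
    rw [Complex.norm_exp]; simp
  rw [norm_smul, h1]
  calc Real.exp (-z.re * t) * ‖T t y‖
      ≤ Real.exp (-z.re * t) * (K * Real.exp (b * t) * ‖y‖) := by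
        gcongr
        exact (T t).le_of_opNorm_le (hK t ht) y
    _ = K * ‖y‖ * (Real.exp (-z.re * t) * Real.exp (b * t)) := by ring
    _ = K * ‖y‖ * Real.exp (-(z.re - b) * t) := by rw [← Real.exp_add]; ring_nf

theorem HasExpBound.tendsto_pow_smul {X : Type*} [NormedAddCommGroup X] [NormedSpace ℂ X]
    {T : ℝ → X →L[ℂ] X} (hb : HasExpBound T b) (hz : b < z.re) (n : ℕ) (y : X) :
    Tendsto (fun t : ℝ => t ^ n • (Complex.exp (-z * t) • T t y)) atTop (𝓝 0) := by
  obtain ⟨K, hK0, hK⟩ := hb.exists_norm_exp_smul_le z y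
  have h := (tendsto_rpow_mul_exp_neg_mul_atTop_nhds_zero n (z.re - b) (by linarith)).const_mul K
  rw [mul_zero] at h
  refine squeeze_zero_norm' ?_ h
  filter_upwards [eventually_ge_atTop 0] with t ht
  rw [norm_smul, Real.norm_of_nonneg (by positivity), Real.rpow_natCast]
  calc _ ≤ t ^ n * (K * Real.exp (-(z.re - b) * t)) := by gcongr; exact hK t ht
    _ = _ := by ring

theorem integrableOn_sq_smul (hT : IsC0Semigroup T) (hb : HasExpBound T b) (hz : b < z.re)
    (y : X) : IntegrableOn (fun t : ℝ => t ^ 2 • (Complex.exp (-z * t) • T t y)) (Ioi 0) := by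
  obtain ⟨K, hK0, hK⟩ := hb.exists_norm_exp_smul_le z y
  have h := (integrableOn_rpow_mul_exp_neg_mul_rpow (p := 1) (s := 2) (b := z.re - b) (by norm_num)
    one_pos (by linarith)).const_mul K
  refine Integrable.mono' h ?_ ?_
  · refine ContinuousOn.aestronglyMeasurable ?_ measurableSet_Ioi
    exact ((continuous_pow 2).continuousOn.smul (hT.continuousOn_exp_smul y z)).mono
      Ioi_subset_Ici_self
  · filter_upwards [ae_restrict_mem measurableSet_Ioi] with t ht
    have ht : 0 < t := ht
    rw [norm_smul, Real.norm_of_nonneg (by positivity), Real.rpow_one, Real.rpow_two]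
    calc _ ≤ t ^ 2 * (K * Real.exp (-(z.re - b) * t)) := by gcongr; exact hK t ht.le
      _ = _ := by ring

/-- The Laplace transform of `t ↦ t ^ 2 T t y` is `2 R(z, A) ^ 3 y`. -/
theorem integral_sq_smul (hT : IsC0Semigroup T) (hA : IsGenerator A T) (hb : HasExpBound T b)
    (hz : b < z.re) (hzA : z ∈ resolventSet A) (y : X) :
    ∫ t in Ioi (0 : ℝ), t ^ 2 • (Complex.exp (-z * t) • T t y) =
      (2 : ℝ) • resolvent A z (resolvent A z (resolvent A z y)) := by
  set R := resolvent A z with hR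
  set G : X → ℝ → X := fun v s => Complex.exp (-z * s) • T s v with hG
  have hGd : ∀ v : X, ∀ t : ℝ, 0 < t → HasDerivAt (G (R v)) (-G v t) t := fun v t ht => by
    have h := hA.hasDerivAt_exp_smul hT ⟨R v, resolvent_mem hzA v⟩ z ht
    have h1 : z • R v - A ⟨R v, resolvent_mem hzA v⟩ = v := by rw [map_resolvent hzA]; abel
    rwa [h1] at h
  -- an explicit primitive, found by integrating by parts twice
  set F : ℝ → X := fun t => -(t ^ 2 • G (R y) t + (2 * t) • G (R (R y)) t +
    (2 : ℝ) • G (R (R (R y))) t) with hF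
  have hFd : ∀ t ∈ Ioi (0 : ℝ), HasDerivAt F (t ^ 2 • G y t) t := fun t (ht : 0 < t) => by
    have h1 := (hasDerivAt_pow 2 t).smul (hGd y t ht)
    have h2 := ((hasDerivAt_id t).const_mul 2).smul (hGd (R y) t ht)
    have h3 := (hGd (R (R y)) t ht).const_smul (2 : ℝ)
    refine ((h1.add h2).add h3).neg.congr_deriv ?_
    simp only [smul_neg, id, Nat.cast_ofNat, Nat.add_one_sub_one, pow_one, mul_one]
    abel
  have hFc : ContinuousWithinAt F (Ici 0) 0 := by
    have hc : ∀ v, ContinuousWithinAt (G v) (Ici 0) 0 := fun v =>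
      hT.continuousOn_exp_smul v z 0 self_mem_Ici
    have hp : ∀ {p : ℝ → ℝ}, Continuous p → ContinuousWithinAt p (Ici 0) 0 :=
      fun h => h.continuousWithinAt
    exact (((hp (by fun_prop)).smul (hc _)).add ((hp (by fun_prop)).smul (hc _))).add
      ((hc _).const_smul _) |>.neg
  have hFt : Tendsto F atTop (𝓝 0) := by
    have h0 := hb.tendsto_pow_smul hz 0 (R (R (R y)))
    have h1 := hb.tendsto_pow_smul hz 1 (R (R y))
    have h2 := hb.tendsto_pow_smul hz 2 (R y)
    have h := ((h2.add (h1.const_smul (2 : ℝ))).add (h0.const_smul (2 : ℝ))).neg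
    simp only [smul_zero, add_zero, neg_zero] at h
    refine h.congr fun t => ?_
    simp only [hF, hG, pow_zero, pow_one, one_smul, mul_smul]
  have h := integral_Ioi_of_hasDerivAt_of_tendsto hFc hFd (integrableOn_sq_smul hT hb hz y) hFt
  rw [h]
  simp [hF, hG, hT.map_zero]

open scoped FourierTransform in
/-- Inversion of the Laplace transform of `t ↦ t ^ 2 T t y` on the line `Re z = a`. The decay
of `R(z, A) ^ 3 y` makes the inversion integral absolutely convergent. -/
theorem norm_apply_le_of_resolvent_cube (hT : IsC0Semigroup T) (hA : IsGenerator A T)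
    (hb : HasExpBound T b) {a : ℝ} (ha : 0 < a) (hba : b < a)
    (hres : ∀ z : ℂ, 0 < z.re → z ∈ resolventSet A) {y : X} {L : ℝ}
    (hL : ∀ z : ℂ, z.re = a →
      ‖resolvent A z (resolvent A z (resolvent A z y))‖ ≤ L / ‖z‖ ^ 2) {t : ℝ} (ht : 0 < t) :
    ‖T t y‖ ≤ Real.exp (a * t) * (L / (a * t ^ 2)) := by
  set f : ℝ → X := (Ioi 0).indicator fun t : ℝ => t ^ 2 • (Complex.exp (-(a : ℂ) * t) • T t y)
    with hf
  have hfint : Integrable f :=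
    (integrable_indicator_iff measurableSet_Ioi).2 (integrableOn_sq_smul hT hb (by simpa) y)
  -- the Fourier transform of `f` is the Laplace transform on the line `Re z = a`
  have hF : ∀ w : ℝ, ‖𝓕 f w‖ ≤ 2 * L / a ^ 2 * (1 + (2 * Real.pi / a * w) ^ 2)⁻¹ := by
    intro w
    set z : ℂ := a + (2 * Real.pi * w : ℝ) * Complex.I with hz
    have hzre : z.re = a := by simp [hz]
    have h1 : 𝓕 f w = (2 : ℝ) • resolvent A z (resolvent A z (resolvent A z y)) := by
      rw [← integral_sq_smul hT hA hb (by rwa [hzre]) (hres z (by rwa [hzre])) y,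
        Real.fourier_real_eq_integral_exp_smul, ← integral_indicator measurableSet_Ioi]
      congr 1
      ext v
      rw [hf, indicator_apply, indicator_apply]
      split_ifs
      · rw [smul_comm, smul_smul, ← Complex.exp_add]
        congr 3
        rw [hz]
        push_cast
        ring
      · simp
    have hn : ‖z‖ ^ 2 = a ^ 2 * (1 + (2 * Real.pi / a * w) ^ 2) := by
      rw [← Complex.normSq_eq_norm_sq, Complex.normSq_apply, hzre]
      have : z.im = 2 * Real.pi * w := by simp [hz]
      rw [this]
      field_simp
    rw [h1, norm_smul, Real.norm_of_nonneg zero_le_two]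
    refine (mul_le_mul_of_nonneg_left (hL z hzre) zero_le_two).trans_eq ?_
    rw [hn]
    have : (1 + (2 * Real.pi / a * w) ^ 2) ≠ 0 := by positivity
    field_simp
  have hc : 2 * Real.pi / a ≠ 0 := by positivity
  have hgint : Integrable fun w : ℝ => 2 * L / a ^ 2 * (1 + (2 * Real.pi / a * w) ^ 2)⁻¹ :=
    (integrable_inv_one_add_sq.comp_mul_left' hc).const_mul _
  have hFint : Integrable (𝓕 f) := by
    refine hgint.mono' ?_ (ae_of_all _ hF)
    exact (VectorFourier.fourierIntegral_continuous Real.continuous_fourierChar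
      (innerSL ℝ).continuous₂ hfint).aestronglyMeasurable
  have hcont : ContinuousAt f t := by
    have h1 : ContinuousAt (fun t : ℝ => t ^ 2 • (Complex.exp (-(a : ℂ) * t) • T t y)) t :=
      ((continuous_pow 2).continuousOn.smul (hT.continuousOn_exp_smul y a)).continuousAt
        (Ici_mem_nhds ht)
    refine h1.congr ?_
    filter_upwards [Ioi_mem_nhds ht] with s hs
    rw [hf, indicator_of_mem hs]
  have hinv := hfint.fourierInv_fourier_eq hFint hcont
  have hft : f t = t ^ 2 • (Complex.exp (-(a : ℂ) * t) • T t y) := indicator_of_mem ht _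
  have hle : ‖f t‖ ≤ L / a := by
    rw [← hinv, Real.fourierInv_eq]
    refine (norm_integral_le_integral_norm _).trans ?_
    simp only [Circle.norm_smul]
    refine (integral_mono hFint.norm hgint hF).trans_eq ?_
    rw [integral_const_mul, Measure.integral_comp_mul_left (fun w : ℝ => (1 + w ^ 2)⁻¹),
      integral_univ_inv_one_add_sq, abs_of_pos (by positivity), smul_eq_mul]
    have := Real.pi_pos
    field_simp
  have hexp : ‖Complex.exp (-(a : ℂ) * t)‖ = (Real.exp (a * t))⁻¹ := by
    rw [Complex.norm_exp, ← Real.exp_neg]; simp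
  rw [hft, norm_smul, norm_smul, hexp, Real.norm_of_nonneg (by positivity)] at hle
  have he := Real.exp_pos (a * t)
  calc ‖T t y‖ = Real.exp (a * t) * (t ^ 2 * ((Real.exp (a * t))⁻¹ * ‖T t y‖)) / t ^ 2 := by
        field_simp
    _ ≤ Real.exp (a * t) * (L / a) / t ^ 2 := by gcongr
    _ = Real.exp (a * t) * (L / (a * t ^ 2)) := by field_simp

end Laplace

/-! ### Bounded analytic semigroups -/

section Analytic

variable {X : Type*} [NormedAddCommGroup X] [NormedSpace ℂ X] [CompleteSpace X]
  {T : ℝ → X →L[ℂ] X} {A : X →ₗ.[ℂ] X} {M : ℝ}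

/-- The estimate for `T t` on the line `Re z = a`, for `a` above the growth bound. The constant
does not depend on the growth bound, and only `a * t` enters. -/
theorem norm_apply_le_of_resolvent_bound (hT : IsC0Semigroup T) (hA : IsGenerator A T)
    (hres : ∀ z : ℂ, 0 < z.re → z ∈ resolventSet A) (hM0 : 0 < M)
    (hM : ∀ z : ℂ, 0 < z.re → ‖z‖ * ‖resolvent A z‖ ≤ M) {a b : ℝ} (hb : HasExpBound T b)
    (ha : 0 < a) (hba : b < a) {t : ℝ} (ht : 0 < t) :
    ‖T t‖ ≤ Real.exp (a * t) * (M ^ 3 / (a * t) ^ 2) := by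
  refine ContinuousLinearMap.opNorm_le_bound _ (by positivity) fun x => ?_
  have h := norm_apply_le_of_resolvent_cube hT hA hb ha hba hres (y := x)
    (L := M ^ 3 * ‖x‖ / a) (fun z hz => ?_) ht
  · refine h.trans_eq ?_
    field_simp
  have hz0 : 0 < z.re := hz ▸ ha
  have hza : a ≤ ‖z‖ := hz ▸ Complex.re_le_norm z
  have hzn : 0 < ‖z‖ := ha.trans_le hza
  have hR : ‖resolvent A z‖ ≤ M / ‖z‖ := by
    rw [le_div_iff₀ hzn, mul_comm]; exact hM z hz0
  have hRx : ∀ v, ‖resolvent A z v‖ ≤ M / ‖z‖ * ‖v‖ := fun v =>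
    (resolvent A z).le_of_opNorm_le hR v
  calc ‖resolvent A z (resolvent A z (resolvent A z x))‖
      ≤ M / ‖z‖ * (M / ‖z‖ * (M / ‖z‖ * ‖x‖)) := by
        refine (hRx _).trans ?_
        gcongr
        refine (hRx _).trans ?_
        gcongr
        exact hRx _
    _ = M ^ 3 * ‖x‖ / ‖z‖ / ‖z‖ ^ 2 := by field_simp
    _ ≤ M ^ 3 * ‖x‖ / a / ‖z‖ ^ 2 := by gcongr

/-- The resolvent bound on the right half-plane forces the growth bound to be nonpositive: the
estimate for `T t` on the line `Re z = a` is scale invariant, so it improves any admissible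
positive exponent by a fixed factor `θ < 1`. -/
theorem hasExpBound_of_resolvent_bound (hT : IsC0Semigroup T) (hA : IsGenerator A T)
    (hres : ∀ z : ℂ, 0 < z.re → z ∈ resolventSet A) (hM0 : 0 < M)
    (hM : ∀ z : ℂ, 0 < z.re → ‖z‖ * ‖resolvent A z‖ ≤ M) {a : ℝ} (ha : 0 < a) :
    ∃ b, b < a ∧ HasExpBound T b := by
  set N : ℝ := Real.exp 2 * (M ^ 3 + 1) with hN
  have hN1 : 1 < N := by
    have h1 : 1 < Real.exp 2 := Real.one_lt_exp_iff.2 two_pos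
    have h2 : 0 < M ^ 3 := by positivity
    nlinarith
  have hN0 : 0 < N := by linarith
  have hstep : ∀ b, 0 < b → HasExpBound T b → HasExpBound T (b * (1 - 1 / N)) := by
    intro b hb hbT
    have hθ : 0 ≤ 1 - 1 / N := by rw [sub_nonneg, div_le_one hN0]; exact hN1.le
    -- the time at which the bound on the line `Re z = b + 1 / t₀` beats `exp (b t₀)`
    set t₀ : ℝ := N / b with ht₀
    have ht₀0 : 0 < t₀ := by positivity
    have hbt : b * t₀ = N := by rw [ht₀]; field_simp
    obtain ⟨K, hK0, hK⟩ := hbT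
    refine hT.hasExpBound_of_norm_le ht₀0 (mul_nonneg hb.le hθ)
      (K := K * Real.exp (b * t₀)) ?_ ?_
    · intro t ht
      refine (hK t ht.1).trans ?_
      gcongr
      exact ht.2
    · have h := norm_apply_le_of_resolvent_bound hT hA hres hM0 hM (a := b + 1 / t₀)
        ⟨K, hK0, hK⟩ (by positivity) (by linarith [one_div_pos.2 ht₀0]) ht₀0
      have h1 : (b + 1 / t₀) * t₀ = N + 1 := by rw [add_mul, hbt]; field_simp
      have h2 : b * (1 - 1 / N) * t₀ = N - 1 := by
        rw [mul_right_comm, hbt]; field_simp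
      rw [h1] at h
      rw [h2]
      refine h.trans ?_
      have h3 : Real.exp (N + 1) = Real.exp (N - 1) * Real.exp 2 := by
        rw [← Real.exp_add]; ring_nf
      rw [h3, mul_assoc]
      refine mul_le_of_le_one_right (Real.exp_pos _).le ?_
      rw [← mul_div_assoc, div_le_one (by positivity)]
      have : Real.exp 2 * M ^ 3 ≤ N := by rw [hN]; nlinarith [Real.exp_pos 2]
      nlinarith
  obtain ⟨b, hb0, hb⟩ := hT.exists_hasExpBound
  have hθ0 : 0 < 1 - 1 / N := by rw [sub_pos, div_lt_one hN0]; exact hN1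
  have hθ1 : 1 - 1 / N < 1 := by linarith [one_div_pos.2 hN0]
  have hiter : ∀ n : ℕ, HasExpBound T (b * (1 - 1 / N) ^ n) := by
    intro n
    induction n with
    | zero => simpa
    | succ n ih =>
      rw [pow_succ, ← mul_assoc]
      exact hstep _ (by positivity) ih
  have hlim := (tendsto_pow_atTop_nhds_zero_of_lt_one hθ0.le hθ1).const_mul b
  rw [mul_zero] at hlim
  obtain ⟨n, hn⟩ := (hlim.eventually_lt_const ha).exists
  exact ⟨_, hn, hiter n⟩

/-- The characteristic estimates of a bounded analytic semigroup. -/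
theorem GeneratesBoundedAnalytic.exists_bounds (hT : IsC0Semigroup T) (hA : IsGenerator A T)
    (hAb : GeneratesBoundedAnalytic A) :
    ∃ K : ℝ, 0 < K ∧ ∀ t : ℝ, 0 < t → ‖T t‖ ≤ K ∧
      ∀ x : X, ∃ hx : T t x ∈ A.domain, ‖A ⟨T t x, hx⟩‖ ≤ K / t * ‖x‖ := by
  obtain ⟨hres, M, hM0, hM⟩ := hAb.exists_resolvent_bound
  refine ⟨Real.exp 1 * M ^ 3 + Real.exp 1 * (M ^ 2 * (M + 1)), by positivity, fun t ht => ?_⟩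
  set K := Real.exp 1 * M ^ 3 + Real.exp 1 * (M ^ 2 * (M + 1)) with hK
  have ht' : 0 < 1 / t := by positivity
  have htt : 1 / t * t = 1 := by field_simp
  obtain ⟨b, hbt, hb⟩ := hasExpBound_of_resolvent_bound hT hA hres hM0 hM ht'
  refine ⟨?_, fun x => ?_⟩
  · have h := norm_apply_le_of_resolvent_bound hT hA hres hM0 hM hb ht' hbt ht
    rw [htt] at h
    refine h.trans ?_
    have : 0 ≤ Real.exp 1 * (M ^ 2 * (M + 1)) := by positivity
    simpa [hK] using this
  -- on the domain, the decay of `R(z, A) ^ 3 A x = R(z, A) ^ 2 (z R(z, A) x - x)` is quadratic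
  have hD : ∀ x : A.domain, ‖T t (A x)‖ ≤ K / t * ‖(x : X)‖ := by
    intro x
    have h := norm_apply_le_of_resolvent_cube hT hA hb ht' hbt hres (y := A x)
      (L := M ^ 2 * (M + 1) * ‖(x : X)‖) (fun z hz => ?_) ht
    · rw [htt] at h
      refine h.trans ?_
      have h1 : 1 / t * t ^ 2 = t := by field_simp
      rw [h1]
      have h2 : 0 ≤ Real.exp 1 * M ^ 3 / t * ‖(x : X)‖ := by positivity
      have h3 : K / t * ‖(x : X)‖ = Real.exp 1 * M ^ 3 / t * ‖(x : X)‖ +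
          Real.exp 1 * (M ^ 2 * (M + 1) * ‖(x : X)‖ / t) := by rw [hK]; ring
      linarith
    have hz0 : 0 < z.re := hz ▸ ht'
    have hzn : 0 < ‖z‖ := hz0.trans_le (Complex.re_le_norm z)
    have hR : ‖resolvent A z‖ ≤ M / ‖z‖ := by
      rw [le_div_iff₀ hzn, mul_comm]; exact hM z hz0
    have hRx : ∀ v, ‖resolvent A z v‖ ≤ M / ‖z‖ * ‖v‖ := fun v =>
      (resolvent A z).le_of_opNorm_le hR v
    have h1 : ‖resolvent A z (A x)‖ ≤ (M + 1) * ‖(x : X)‖ := by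
      rw [resolvent_map (hres z hz0)]
      refine (norm_sub_le _ _).trans ?_
      rw [norm_smul, add_mul, one_mul]
      refine add_le_add ?_ le_rfl
      calc ‖z‖ * ‖resolvent A z x‖ ≤ ‖z‖ * (M / ‖z‖ * ‖(x : X)‖) := by gcongr; exact hRx _
        _ = M * ‖(x : X)‖ := by field_simp
    calc ‖resolvent A z (resolvent A z (resolvent A z (A x)))‖
        ≤ M / ‖z‖ * (M / ‖z‖ * ((M + 1) * ‖(x : X)‖)) := by
          refine (hRx _).trans ?_
          gcongr
          refine (hRx _).trans ?_
          gcongr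
      _ = M ^ 2 * (M + 1) * ‖(x : X)‖ / ‖z‖ ^ 2 := by field_simp
  -- closedness of `A` carries the bound from the dense domain to all of `X`
  obtain ⟨u, huA, hux⟩ := mem_closure_iff_seq_limit.1 (hAb.1 x)
  set v : ℕ → A.domain := fun n => ⟨u n, huA n⟩
  have hv : Tendsto (fun n => (v n : X)) atTop (𝓝 x) := hux
  have hK0 : 0 < K := by positivity
  have hcau : CauchySeq fun n => T t (A (v n)) := by
    refine Metric.cauchySeq_iff.2 fun ε hε => ?_
    obtain ⟨n₀, hn₀⟩ := Metric.cauchySeq_iff.1 hux.cauchySeq (ε / (K / t)) (by positivity)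
    refine ⟨n₀, fun m hm n hn => ?_⟩
    rw [dist_eq_norm, ← map_sub, ← LinearPMap.map_sub]
    refine (hD _).trans_lt ?_
    have := hn₀ m hm n hn
    rw [lt_div_iff₀ (by positivity), dist_eq_norm, mul_comm] at this
    exact this
  obtain ⟨w, hw⟩ := cauchySeq_tendsto_of_complete hcau
  choose hmem hmap using fun n => hA.map_apply hT (v n) ht.le
  obtain ⟨hx, hxw⟩ := mem_domain_of_tendsto (hres 1 (by simp))
    (u := fun n => ⟨T t (v n), hmem n⟩) (((T t).continuous.tendsto x).comp hv)
    (by simpa only [hmap] using hw)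
  refine ⟨hx, ?_⟩
  rw [hxw]
  exact le_of_tendsto_of_tendsto' hw.norm (hv.norm.const_mul _) fun n => hD (v n)

end Analytic

/-! ### The Weiss condition -/

section Observation

variable {X Y : Type*} [NormedAddCommGroup X] [NormedSpace ℂ X]
  [NormedAddCommGroup Y] [NormedSpace ℂ Y] {A : X →ₗ.[ℂ] X} {C : A.domain →ₗ[ℂ] Y} {Φ : ℝ → ℝ}

theorem evalAt_of_mem (C : A.domain →ₗ[ℂ] Y) {x : X} (hx : x ∈ A.domain) :
    evalAt C x = C ⟨x, hx⟩ :=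
  dif_pos hx

/-- `C R(z, A)` as a bounded operator. -/
theorem IsGraphBounded.exists_clm (hC : IsGraphBounded A C) {z : ℂ} (hz : z ∈ resolventSet A) :
    ∃ B : X →L[ℂ] Y, (∀ x, B x = evalAt C (resolvent A z x)) ∧
      ∀ x : A.domain, B (z • (x : X) - A x) = C x := by
  obtain ⟨K, hK⟩ := hC
  set R := resolvent A z with hR
  let S : X →ₗ[ℂ] Y := C.comp ((R : X →ₗ[ℂ] X).codRestrict A.domain (resolvent_mem hz))
  have hS : ∀ x, S x = C ⟨R x, resolvent_mem hz x⟩ := fun x => rfl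
  refine ⟨S.mkContinuous (|K| * (‖R‖ + (‖z‖ * ‖R‖ + 1))) fun x => ?_, fun x => ?_, fun x => ?_⟩
  · rw [hS]
    refine (hK _).trans ?_
    rw [map_resolvent hz, mul_assoc]
    have h1 : ‖R x‖ ≤ ‖R‖ * ‖x‖ := R.le_opNorm x
    have h2 : ‖z • R x - x‖ ≤ (‖z‖ * ‖R‖ + 1) * ‖x‖ := by
      refine (norm_sub_le _ _).trans ?_
      rw [norm_smul, add_mul, one_mul, mul_assoc]
      exact add_le_add (mul_le_mul_of_nonneg_left h1 (norm_nonneg _)) le_rfl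
    calc K * (‖R x‖ + ‖z • R x - x‖) ≤ |K| * (‖R x‖ + ‖z • R x - x‖) := by
          gcongr
          exact le_abs_self K
      _ ≤ |K| * ((‖R‖ + (‖z‖ * ‖R‖ + 1)) * ‖x‖) := by
          gcongr
          linarith
  · rw [LinearMap.mkContinuous_apply, hS, evalAt_of_mem]
  · rw [LinearMap.mkContinuous_apply, hS]
    congr 1
    exact Subtype.ext (resolvent_smul_sub hz x)

/-- The Weiss condition with the Luxemburg norm of the exponential replaced by the equivalent
quantity `inv Φ r / r`. -/
theorem infiniteTimeWeiss_iff (hΦ : ClassP Φ) (hC : IsGraphBounded A C)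
    (hres : ∀ z : ℂ, 0 < z.re → z ∈ resolventSet A) :
    InfiniteTimeWeiss A C Φ ↔ ∃ K : ℝ, 0 ≤ K ∧ ∀ z : ℂ, 0 < z.re → ∀ x : X,
      ‖evalAt C (resolvent A z x)‖ ≤ K * (inv Φ z.re / z.re) * ‖x‖ := by
  constructor
  · rintro ⟨-, h⟩
    set S := ⨆ (z : ℂ) (_ : 0 < z.re),
      (luxemburgNorm (complementary Φ) (fun t : ℝ => Real.exp (-z.re * t))
          (volume.restrict (Ioi 0)))⁻¹ *
        opNorm (fun x : X => evalAt C (resolvent A z x)) with hS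
    refine ⟨S.toReal, ENNReal.toReal_nonneg, fun z hz x => ?_⟩
    obtain ⟨B, hB, -⟩ := hC.exists_clm (hres z hz)
    have hψ := hΦ.inv_pos hz
    have hle := le_iSup₂ (f := fun (z : ℂ) (_ : 0 < z.re) =>
      (luxemburgNorm (complementary Φ) (fun t : ℝ => Real.exp (-z.re * t))
          (volume.restrict (Ioi 0)))⁻¹ *
        opNorm (fun x : X => evalAt C (resolvent A z x))) z hz
    rw [← hS] at hle
    have hN := hΦ.luxemburgNorm_exp_le hz
    have hN' : ENNReal.ofReal (inv Φ z.re / z.re) ≠ 0 := by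
      simpa using div_pos hψ hz
    have h1 : opNorm (fun x : X => evalAt C (resolvent A z x)) ≤
        ENNReal.ofReal (S.toReal * (inv Φ z.re / z.re)) := by
      rw [ENNReal.ofReal_mul ENNReal.toReal_nonneg, ENNReal.ofReal_toReal h.ne,
        ← ENNReal.div_le_iff hN' ENNReal.ofReal_ne_top, div_eq_mul_inv, mul_comm]
      exact (mul_le_mul_left (ENNReal.inv_le_inv.2 hN) _).trans hle
    rw [← hB]
    refine B.le_of_opNorm_le (ContinuousLinearMap.opNorm_le_of_unit_norm (by positivity)
      fun x hx => ?_) x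
    have h2 := (le_iSup₂ (f := fun (x : X) (_ : ‖x‖ ≤ 1) => ‖evalAt C (resolvent A z x)‖ₑ)
      x hx.le).trans h1
    rw [← hB, ← ofReal_norm] at h2
    exact (ENNReal.ofReal_le_ofReal_iff (by positivity)).1 h2
  · rintro ⟨K, hK0, hK⟩
    refine ⟨fun z hz => hres z hz, lt_of_le_of_lt (b := ENNReal.ofReal (K * (2 * Real.exp 1)))
      (iSup₂_le fun z hz => ?_) ENNReal.ofReal_lt_top⟩
    have hψ := hΦ.inv_pos hz
    have hz' : 0 < z.re := hz
    have he := Real.exp_pos 1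
    have hN := hΦ.le_luxemburgNorm_exp hz
    have hpos : 0 < inv Φ z.re / (2 * Real.exp 1 * z.re) := by positivity
    have h1 : opNorm (fun x : X => evalAt C (resolvent A z x)) ≤
        ENNReal.ofReal (K * (inv Φ z.re / z.re)) := by
      refine iSup₂_le fun x hx => ?_
      rw [← ofReal_norm]
      exact ENNReal.ofReal_le_ofReal ((hK z hz x).trans
        (mul_le_of_le_one_right (by positivity) hx))
    refine (mul_le_mul' (ENNReal.inv_le_inv.2 hN) h1).trans_eq ?_
    rw [← ENNReal.ofReal_inv_of_pos hpos, ← ENNReal.ofReal_mul (by positivity)]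
    congr 1
    field_simp

end Observation

/-! ### Relations between the three conditions -/

section Equivalence

variable {X Y : Type*} [NormedAddCommGroup X] [NormedSpace ℂ X] [CompleteSpace X]
  [NormedAddCommGroup Y] [NormedSpace ℂ Y] {A : X →ₗ.[ℂ] X} {C : A.domain →ₗ[ℂ] Y} {Φ : ℝ → ℝ}
  {T : ℝ → X →L[ℂ] X}

theorem InfiniteTimeWeiss.exists_norm_le (hΦ : ClassP Φ) (hC : IsGraphBounded A C)
    (hT : IsC0Semigroup T) (hA : IsGenerator A T) (hAb : GeneratesBoundedAnalytic A)
    (h : InfiniteTimeWeiss A C Φ) :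
    ∃ M : ℝ, 0 < M ∧ ∀ x : X, ∀ t : ℝ, 0 < t → ∃ hx : T t x ∈ A.domain,
      (inv Φ (1 / t))⁻¹ * ‖C ⟨T t x, hx⟩‖ ≤ M * ‖x‖ := by
  obtain ⟨hres, -⟩ := hAb.exists_resolvent_bound
  obtain ⟨K₁, hK₁0, hK₁⟩ := (infiniteTimeWeiss_iff hΦ hC hres).1 h
  obtain ⟨K, hK0, hK⟩ := hAb.exists_bounds hT hA
  refine ⟨K₁ * (2 * K) + 1, by positivity, fun x t ht => ?_⟩
  obtain ⟨hTt, hAT⟩ := hK t ht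
  obtain ⟨hx, hATx⟩ := hAT x
  refine ⟨hx, ?_⟩
  have ht' : 0 < 1 / t := by positivity
  have hψ := hΦ.inv_pos ht'
  have hre : 0 < ((1 / t : ℝ) : ℂ).re := by simpa using ht
  obtain ⟨B, hB, hBC⟩ := hC.exists_clm (hres _ hre)
  have h1 := hBC ⟨T t x, hx⟩
  have h2 := hK₁ _ hre (((1 / t : ℝ) : ℂ) • T t x - A ⟨T t x, hx⟩)
  rw [← hB, h1, Complex.ofReal_re] at h2
  have h3 : ‖((1 / t : ℝ) : ℂ) • T t x - A ⟨T t x, hx⟩‖ ≤ 2 * K / t * ‖x‖ := by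
    refine (norm_sub_le _ _).trans ?_
    rw [norm_smul, Complex.norm_of_nonneg ht'.le]
    have h4 := mul_le_mul_of_nonneg_left ((T t).le_of_opNorm_le hTt x) ht'.le
    calc _ ≤ 1 / t * (K * ‖x‖) + K / t * ‖x‖ := add_le_add h4 hATx
      _ = _ := by ring
  rw [inv_mul_le_iff₀ hψ]
  calc ‖C ⟨T t x, hx⟩‖
      ≤ K₁ * (inv Φ (1 / t) / (1 / t)) * (2 * K / t * ‖x‖) := by
        refine h2.trans ?_
        gcongr
    _ = inv Φ (1 / t) * (K₁ * (2 * K) * ‖x‖) := by field_simp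
    _ ≤ inv Φ (1 / t) * ((K₁ * (2 * K) + 1) * ‖x‖) := by
        gcongr
        linarith

theorem infiniteTimeWeakAdmissible_of_norm_le (hΦ : ClassP Φ) (hC : IsGraphBounded A C)
    (hT : IsC0Semigroup T) (hA : IsGenerator A T) {z : ℂ} (hz : z ∈ resolventSet A) {M : ℝ}
    (hM0 : 0 < M) (hM : ∀ x : X, ∀ t : ℝ, 0 < t → ∃ hx : T t x ∈ A.domain,
      (inv Φ (1 / t))⁻¹ * ‖C ⟨T t x, hx⟩‖ ≤ M * ‖x‖) :
    InfiniteTimeWeakAdmissible A T C Φ := by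
  refine ⟨2 * M, by positivity, fun τ hτ x hx => ?_⟩
  have hle : weakOrliczNorm Φ (fun t => evalAt C (T t x)) (volume.restrict (Ioo 0 τ)) ≤
      ENNReal.ofReal (2 * M * ‖x‖) := by
    rw [mul_assoc]
    refine hΦ.weakOrliczNorm_le (by positivity) fun r hr => ?_
    obtain ⟨hx, h⟩ := hM x r hr.1
    rw [evalAt_of_mem C hx, mul_comm]
    rwa [inv_mul_le_iff₀ (hΦ.inv_pos (one_div_pos.2 hr.1))] at h
  refine ⟨⟨?_, hle.trans_lt ENNReal.ofReal_lt_top⟩, hle⟩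
  obtain ⟨B, -, hB⟩ := hC.exists_clm hz
  have hcont : ContinuousOn (fun t => B (T t (z • x - A ⟨x, hx⟩))) (Ioo 0 τ) :=
    B.continuous.comp_continuousOn ((hT.continuousOn _).mono fun t ht => ht.1.le)
  refine (hcont.aestronglyMeasurable measurableSet_Ioo).congr ?_
  filter_upwards [ae_restrict_mem measurableSet_Ioo] with t ht
  obtain ⟨hTx, hAT⟩ := hA.map_apply hT ⟨x, hx⟩ ht.1.le
  rw [evalAt_of_mem C hTx, ← hB, hAT, map_sub (T t), map_smul]

/-- The truncated Laplace transform of `C T(·) x`, which needs no integrability at infinity. -/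
theorem IsGraphBounded.norm_sub_exp_smul_le [CompleteSpace Y] (hT : IsC0Semigroup T)
    (hA : IsGenerator A T) {l : ℝ} (hl : 0 < l) {B : X →L[ℂ] Y}
    (hB : ∀ x : A.domain, B ((l : ℂ) • (x : X) - A x) = C x) (x : A.domain) {t J : ℝ}
    (ht : 0 < t) (hJ0 : 0 ≤ J)
    (hJ : ∫⁻ r in Ioo 0 t, ENNReal.ofReal ‖evalAt C (T r x)‖ ≤ ENNReal.ofReal J) :
    ‖B x - B (Complex.exp (-(l : ℂ) * t) • T t x)‖ ≤ J := by
  set F : ℝ → Y := fun s => B (Complex.exp (-(l : ℂ) * s) • T s x) with hF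
  set y : X := (l : ℂ) • (x : X) - A x with hy
  set F' : ℝ → Y := fun s => B (-(Complex.exp (-(l : ℂ) * s) • T s y)) with hF'
  have hsub : Icc 0 t ⊆ Ici 0 := fun s hs => hs.1
  have hFc : ContinuousOn F (Icc 0 t) :=
    B.continuous.comp_continuousOn ((hT.continuousOn_exp_smul _ _).mono hsub)
  have hF'c : ContinuousOn F' (Icc 0 t) :=
    B.continuous.comp_continuousOn ((hT.continuousOn_exp_smul _ _).mono hsub).neg
  have hFd : ∀ s ∈ Ioo 0 t, HasDerivAt F (F' s) s := fun s hs =>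
    (B.restrictScalars ℝ).hasFDerivAt.comp_hasDerivAt s (hA.hasDerivAt_exp_smul hT x l hs.1)
  have hint := intervalIntegral.integral_eq_sub_of_hasDerivAt_of_le ht.le hFc hFd
    (hF'c.intervalIntegrable_of_Icc ht.le)
  have hF0 : F 0 = B x := by simp [hF, hT.map_zero]
  rw [norm_sub_rev, ← hF0, ← hint, intervalIntegral.integral_of_le ht.le,
    integral_Ioc_eq_integral_Ioo]
  refine (norm_integral_le_lintegral_norm _).trans (ENNReal.toReal_le_of_le_ofReal hJ0
    (le_trans ?_ hJ))
  refine setLIntegral_mono' measurableSet_Ioo fun s hs => ENNReal.ofReal_le_ofReal ?_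
  obtain ⟨hTx, hAT⟩ := hA.map_apply hT x hs.1.le
  have h1 : F' s = -(Complex.exp (-(l : ℂ) * s) • evalAt C (T s x)) := by
    rw [evalAt_of_mem C hTx, ← hB, hAT, hF', hy]
    simp only [map_neg, map_smul, map_sub]
  have h2 : ‖Complex.exp (-(l : ℂ) * s)‖ ≤ 1 := by
    rw [Complex.norm_exp, Real.exp_le_one_iff]
    have : 0 ≤ l * s := mul_nonneg hl.le hs.1.le
    simpa using this
  rw [h1, norm_neg, norm_smul]
  exact mul_le_of_le_one_left (norm_nonneg _) h2

/-- First for real `z`, by absorbing the remainder of the truncated Laplace transform, then for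
complex `z` by the resolvent identity. -/
theorem InfiniteTimeWeakAdmissible.infiniteTimeWeiss [CompleteSpace Y] (hΦ : ClassP Φ)
    (hC : IsGraphBounded A C) (hT : IsC0Semigroup T) (hA : IsGenerator A T)
    (hAb : GeneratesBoundedAnalytic A) (h : InfiniteTimeWeakAdmissible A T C Φ) :
    InfiniteTimeWeiss A C Φ := by
  obtain ⟨hres, M, hM0, hM⟩ := hAb.exists_resolvent_bound
  obtain ⟨K, hK0, hK⟩ := hAb.exists_bounds hT hA
  obtain ⟨c, hc0, hc⟩ := h
  obtain ⟨L, hL0, hL⟩ := hΦ.exists_lintegral_le (Y := Y)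
  refine (infiniteTimeWeiss_iff hΦ hC hres).2
    ⟨2 * (L * (c + 1) * (2 * K + 1)) * (1 + 2 * M), by positivity, fun z hz x => ?_⟩
  set a := z.re with ha
  have hψ := hΦ.inv_pos hz
  have hare : 0 < (a : ℂ).re := by simpa using hz
  obtain ⟨B, hB, hBC⟩ := hC.exists_clm (hres _ hare)
  set D : ℝ := L * (c + 1) * (2 * K + 1) * (inv Φ a / a) with hD
  have hD0 : 0 < D := by positivity
  -- at `t = (2 K + 1) / a` the remainder of the Laplace integral is absorbed
  have hBD : ∀ x ∈ A.domain, ‖B x‖ ≤ (‖B‖ / 2 + D) * ‖x‖ := by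
    intro x hx
    rcases eq_or_ne x 0 with rfl | hx0
    · simp
    have hxn : 0 < ‖x‖ := norm_pos_iff.2 hx0
    set t := (2 * K + 1) / a with ht_def
    have ht : 0 < t := by positivity
    obtain ⟨⟨hmeas, -⟩, hw⟩ := hc t ht x hx
    have hw' : weakOrliczNorm Φ (fun t => evalAt C (T t x)) (volume.restrict (Ioo 0 t)) ≤
        ENNReal.ofReal ((c + 1) * ‖x‖) :=
      hw.trans (ENNReal.ofReal_le_ofReal (by nlinarith))
    have hψt := hΦ.inv_pos (one_div_pos.2 ht)
    have h1 := IsGraphBounded.norm_sub_exp_smul_le hT hA hz hBC ⟨x, hx⟩ ht (by positivity)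
      (hL _ t _ ht (by positivity) hmeas hw')
    have hta : 1 / t ≤ a := by
      rw [ht_def, one_div_div, div_le_iff₀ (by positivity)]
      nlinarith
    have h2 : L * ((c + 1) * ‖x‖) * (t * inv Φ (1 / t)) ≤ D * ‖x‖ := by
      calc L * ((c + 1) * ‖x‖) * (t * inv Φ (1 / t))
          ≤ L * ((c + 1) * ‖x‖) * (t * inv Φ a) := by
            gcongr
            exact hΦ.inv_mono (one_div_pos.2 ht) hta
        _ = D * ‖x‖ := by rw [hD, ht_def]; ring
    have h3 : ‖B (Complex.exp (-(a : ℂ) * t) • T t x)‖ ≤ ‖B‖ / 2 * ‖x‖ := by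
      have hexp : ‖Complex.exp (-(a : ℂ) * t)‖ * K ≤ 1 / 2 := by
        have hat : a * t = 2 * K + 1 := by rw [ht_def]; field_simp
        have h4 : ‖Complex.exp (-(a : ℂ) * t)‖ = (Real.exp (2 * K + 1))⁻¹ := by
          rw [Complex.norm_exp, ← Real.exp_neg, ← hat]; simp
        rw [h4, inv_mul_le_iff₀ (Real.exp_pos _)]
        linarith [Real.add_one_le_exp (2 * K + 1)]
      calc _ ≤ ‖B‖ * (‖Complex.exp (-(a : ℂ) * t)‖ * (K * ‖x‖)) := by
            refine (B.le_opNorm _).trans ?_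
            rw [norm_smul]
            gcongr
            exact (T t).le_of_opNorm_le (hK t ht).1 x
        _ = ‖B‖ * (‖Complex.exp (-(a : ℂ) * t)‖ * K) * ‖x‖ := by ring
        _ ≤ ‖B‖ * (1 / 2) * ‖x‖ := by gcongr
        _ = _ := by ring
    calc ‖B x‖ ≤ ‖B x - B (Complex.exp (-(a : ℂ) * t) • T t x)‖ +
          ‖B (Complex.exp (-(a : ℂ) * t) • T t x)‖ := norm_le_norm_sub_add _ _
      _ ≤ (‖B‖ / 2 + D) * ‖x‖ := by linarith
  have hBD' : ∀ x, ‖B x‖ ≤ (‖B‖ / 2 + D) * ‖x‖ := fun x =>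
    closure_minimal (s := (A.domain : Set X)) (t := {x | ‖B x‖ ≤ (‖B‖ / 2 + D) * ‖x‖}) hBD
      (isClosed_le (by fun_prop) (by fun_prop)) (hAb.1 x)
  have hBn : ‖B‖ ≤ 2 * D := by
    have := B.opNorm_le_bound (by positivity) hBD'
    linarith
  -- the resolvent identity moves from `a = Re z` to `z`
  have hx1 : ‖x + ((a : ℂ) - z) • resolvent A z x‖ ≤ (1 + 2 * M) * ‖x‖ := by
    have h1 : ‖(a : ℂ) - z‖ ≤ 2 * ‖z‖ := by
      refine (norm_sub_le _ _).trans ?_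
      rw [Complex.norm_of_nonneg hz.le]
      linarith [Complex.re_le_norm z]
    refine (norm_add_le _ _).trans ?_
    rw [norm_smul, add_mul, one_mul]
    refine add_le_add le_rfl ?_
    calc ‖(a : ℂ) - z‖ * ‖resolvent A z x‖
        ≤ 2 * ‖z‖ * (‖resolvent A z‖ * ‖x‖) := by
          gcongr
          exact (resolvent A z).le_opNorm x
      _ = 2 * (‖z‖ * ‖resolvent A z‖) * ‖x‖ := by ring
      _ ≤ 2 * M * ‖x‖ := by
          gcongr
          exact hM z hz
  rw [resolvent_eq_resolvent_apply (hres z hz) (hres _ hare), ← hB]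
  calc _ ≤ 2 * D * ((1 + 2 * M) * ‖x‖) := by
        refine (B.le_opNorm _).trans ?_
        gcongr
    _ = _ := by rw [hD]; ring

end Equivalence

end OrliczWeiss

theorem theorem4p8
    {X Y : Type*} [NormedAddCommGroup X] [NormedSpace ℂ X] [CompleteSpace X]
    [NormedAddCommGroup Y] [NormedSpace ℂ Y] [CompleteSpace Y]
    (T : ℝ → X →L[ℂ] X) (hT : OrliczWeiss.IsC0Semigroup T)
    (A : X →ₗ.[ℂ] X) (hA : OrliczWeiss.IsGenerator A T)
    (hAb : OrliczWeiss.GeneratesBoundedAnalytic A)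
    (Φ : ℝ → ℝ) (hΦ : OrliczWeiss.ClassP Φ)
    (C : A.domain →ₗ[ℂ] Y) (hC : OrliczWeiss.IsGraphBounded A C) :
    List.TFAE [
      OrliczWeiss.InfiniteTimeWeiss A C Φ,
      ∃ M : ℝ, 0 < M ∧ ∀ x : X, ∀ t : ℝ, 0 < t →
        ∃ hx : T t x ∈ A.domain,
          (OrliczWeiss.inv Φ (1 / t))⁻¹ * ‖C ⟨T t x, hx⟩‖ ≤ M * ‖x‖,
      OrliczWeiss.InfiniteTimeWeakAdmissible A T C Φ] := by
  tfae_have 1 → 2 := fun h => h.exists_norm_le hΦ hC hT hA hAb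
  tfae_have 2 → 3 := fun ⟨_, hM0, hM⟩ =>
    OrliczWeiss.infiniteTimeWeakAdmissible_of_norm_le hΦ hC hT hA
      (hAb.exists_resolvent_bound.1 1 (by simp)) hM0 hM
  tfae_have 3 → 1 := fun h => h.infiniteTimeWeiss hΦ hC hT hA hAb
  tfae_finish
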